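/- **Conventions.** Characters and virtual characters of $S_n$ are regarded as complex class functions. Let $\Lambda_{\mathbb C}=\mathbb C[p_1,p_2,\dots]$ be the ring of symmetric functions ($p_d=\sum_i x_i^d$), and let $\mathrm{ch}(f)=\frac1{n!}\sum_{w\in S_n}f(w)\,p_{\lambda(w)}$ be the Frobenius characteristic, where $\lambda(w)$ is the cycle type of $w$ and $p_\lambda=p_{\lambda_1}p_{\lambda_2}\cdots$; it is injective on class functions of $S_n$. Put $h_n=\mathrm{ch}(\mathbf 1_{S_n})$ and $e_n=\mathrm{ch}(\epsilon_n)$, where $\epsilon_n$ is the sign character of $S_n$, and $e_k=0$ for $k<0$. The irreducible character $\chi^\lambda$ of $S_n$ is the one with $\mathrm{ch}(\chi^\lambda)=s_\lambda=\det(e_{\lambda^t_i-i+j})_{i,j=1}^{\lambda_1}$, where $\lambda^t$ is the conjugate partition. Plethysm $f[g]$ is the $\mathbb C$-algebra homomorphism in $f$ determined by $p_k\mapsto p_k[g]$, where $g\mapsto p_k[g]$ is the $\mathbb C$-algebra homomorphism with $p_k[p_j]=p_{kj}$. The arrow $\uparrow$ denotes induction of (virtual) characters. For $n\ge 1$ let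 $c$ be an $n$-cycle in $S_n$, let $C_n=\langle c\rangle$, and let $\mathrm{Lie}_{(n)}=\theta_n\uparrow_{C_n}^{S_n}$, where $\theta_n:C_n\to\mathbb C^\times$ is any linear character sending $c$ to a primitive $n$-th root of unity. Let $\ell_n=\mathrm{ch}(\mathrm{Lie}_{(n)})$ and $\pi_n=\mathrm{ch}(\epsilon_n\otimes\mathrm{Lie}_{(n)})$. For a partition $\lambda=1^{m_1}2^{m_2}\cdots$ of $n$, let $\mathrm{Lie}_\lambda$ and $W_\lambda$ be the characters of $S_n$ with $$\mathrm{ch}(\mathrm{Lie}_\lambda)=\prod_{j\ge1}h_{m_j}[\ell_j],\qquad \mathrm{ch}(W_\lambda)=\prod_{j\ \mathrm{odd}}h_{m_j}[\pi_j]\prod_{j\ \mathrm{even}}e_{m_j}[\pi_j].$$ The rank of $\lambda$ is $\sum_k(\lambda_k-1)$. Let $\widehat{\mathrm{Lie}}{}_n^i=\sum_\lambda\mathrm{Lie}_\lambda$ and $\widehat W{}_n^i=\sum_\lambda W_\lambda$, the sums being over the partitions $\lambda$ of $n$ of rank $i$ with no part equal to $1$, and let $\widehat{\mathrm{Lie}}_n=\sum_i\widehat{\mathrm{Lie}}{}_n^i$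 and $\widehat W_n=\sum_i\widehat W{}_n^i$. **Theorem 1.2.** One has $\widehat{\mathrm{Lie}}_0=\widehat W_0=\mathbf 1_{S_0}$ and $\widehat{\mathrm{Lie}}_1=\widehat W_1=0$, and for every $n\ge1$ $$\widehat{\mathrm{Lie}}_n=\widehat{\mathrm{Lie}}_{n-1}\uparrow_{S_{n-1}}^{S_n}+(-1)^n\epsilon_n,\qquad \widehat W_n=\widehat W_{n-1}\uparrow_{S_{n-1}}^{S_n}+(-1)^n\tau_n,$$ where $\tau_n$ is the virtual character of $S_n$ given by $$\tau_n=\begin{cases}\mathbf 1_{S_n}&\text{for }n=0,1,2,3,\\ \chi^{(3,1^{n-3})}-\chi^{(2,2,1^{n-4})}&\text{for }n\ge4,\end{cases}$$ and $\tau_n$ has degree one, i.e. $\tau_n(1)=1$, for every $n\ge 0$. -/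

import Mathlib

noncomputable section

namespace DerangementChar

open scoped Classical in
/-- Induction of class functions along an (injective) homomorphism `φ : H →* G` of finite groups,
given by Frobenius' formula
`(χ↑)(g) = (1/|H|) ∑_{x ∈ G} ∑_{h ∈ H, φ h = x⁻¹ g x} χ h`. -/
def induce {H G : Type*} [Group H] [Fintype H] [Group G] [Fintype G]
    (φ : H →* G) (χ : H → ℂ) (g : G) : ℂ :=
  (Fintype.card H : ℂ)⁻¹ * ∑ x : G, ∑ h : H, if φ h = x⁻¹ * g * x then χ h else 0

/-- The standard inclusion `S_n → S_{n+1}`, with image the permutations fixing the last point. -/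
def inclS (n : ℕ) : Equiv.Perm (Fin n) →* Equiv.Perm (Fin (n + 1)) :=
  Equiv.Perm.viaEmbeddingHom Fin.castSuccEmb

/-- Induction of (virtual) characters from `S_n` to `S_{n+1}`. -/
def indS {n : ℕ} (χ : Equiv.Perm (Fin n) → ℂ) : Equiv.Perm (Fin (n + 1)) → ℂ :=
  induce (inclS n) χ

/-- The sign character `ε_n` of `S_n`. -/
def signChar (n : ℕ) (w : Equiv.Perm (Fin n)) : ℂ := ((Equiv.Perm.sign w : ℤ) : ℂ)

/-- The ring of symmetric functions with complex coefficients, presented as the polynomial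
ring on the power sums `p_1, p_2, …`; the variable `X k` is the power sum `p_k`. -/
abbrev Symm : Type := MvPolynomial ℕ+ ℂ

/-- The exponent vector of the monomial `p_λ = ∏ p_{λ_i}`, for a multiset of positive integers:
the exponent of `p_k` is the number of parts of `λ` equal to `k`. -/
def typeExp (s : Multiset ℕ) : ℕ+ →₀ ℕ :=
  Multiset.toFinsupp (s.map Nat.toPNat')

/-- The power sum product `p_{λ(w)}`, where `λ(w)` is the cycle type of `w`
(fixed points included). -/
def pCycle {n : ℕ} (w : Equiv.Perm (Fin n)) : Symm :=
  MvPolynomial.monomial (typeExp w.partition.parts) 1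

/-- The Frobenius characteristic `ch f = (1/n!) ∑_w f(w) p_{λ(w)}`. -/
def ch {n : ℕ} (f : Equiv.Perm (Fin n) → ℂ) : Symm :=
  (n.factorial : ℂ)⁻¹ • ∑ w : Equiv.Perm (Fin n), f w • pCycle w

/-- The inverse Frobenius characteristic in degree `n`: writing `F = ∑_λ f(λ) p_λ / z_λ`, the value
at `w` is `f(λ(w))`, i.e. the coefficient of `p_{λ(w)}` in `F` multiplied by
`z_{λ(w)} = |Z_{S_n}(w)|`. -/
def chInv (n : ℕ) (F : Symm) (w : Equiv.Perm (Fin n)) : ℂ :=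
  (Nat.card (Subgroup.centralizer {w}) : ℂ) * F.coeff (typeExp w.partition.parts)

theorem typeExp_injOn {s t : Multiset ℕ} (hs : ∀ k ∈ s, 0 < k) (ht : ∀ k ∈ t, 0 < k)
    (h : typeExp s = typeExp t) : s = t := by
  have h1 : s.map Nat.toPNat' = t.map Nat.toPNat' := Multiset.toFinsupp.injective h
  have key : ∀ u : Multiset ℕ, (∀ k ∈ u, 0 < k) →
      (u.map Nat.toPNat').map (fun k : ℕ+ => (k : ℕ)) = u := by
    intro u hu
    rw [Multiset.map_map]
    conv_rhs => rw [← Multiset.map_id u]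
    refine Multiset.map_congr rfl fun k hk => ?_
    simp [Nat.toPNat'_coe, hu k hk]
  rw [← key s hs, ← key t ht, h1]

/-- `chInv n` inverts `ch` on class functions. -/
theorem chInv_ch {n : ℕ} (f : Equiv.Perm (Fin n) → ℂ) (hf : ∀ x w, f (x * w * x⁻¹) = f w) :
    chInv n (ch f) = f := by
  classical
  funext w
  have hcoef : (ch f).coeff (typeExp w.partition.parts) =
      (n.factorial : ℂ)⁻¹ * ∑ v : Equiv.Perm (Fin n), if IsConj v w then f w else 0 := by
    simp only [ch, MvPolynomial.coeff_smul, MvPolynomial.coeff_sum, pCycle,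
      MvPolynomial.coeff_monomial, smul_eq_mul]
    refine congrArg _ (Finset.sum_congr rfl fun v _ => ?_)
    by_cases hvw : IsConj v w
    · have : v.partition = w.partition := Equiv.Perm.partition_eq_of_isConj.1 hvw
      obtain ⟨x, hx⟩ := isConj_iff.1 hvw
      have hfv : f w = f v := by rw [← hx, hf]
      rw [this, if_pos rfl, if_pos hvw, mul_one, hfv]
    · have : typeExp v.partition.parts ≠ typeExp w.partition.parts := by
        intro h
        apply hvw
        rw [Equiv.Perm.partition_eq_of_isConj]
        exact Nat.Partition.ext (typeExp_injOn (fun k hk => v.partition.parts_pos hk)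
          (fun k hk => w.partition.parts_pos hk) h)
      rw [if_neg this, if_neg hvw, mul_zero]
  rw [chInv, hcoef, ← Finset.sum_filter, Finset.sum_const, nsmul_eq_mul]
  have horb : (Finset.univ.filter (fun v : Equiv.Perm (Fin n) => IsConj v w)).card =
      Nat.card (MulAction.orbit (ConjAct (Equiv.Perm (Fin n))) w) := by
    exact (Nat.subtype_card _ fun v => by
      rw [Finset.mem_filter, ConjAct.mem_orbit_conjAct]; simp).symm
  have hcard : (Nat.card (Subgroup.centralizer {w}) : ℂ) *
      ((Finset.univ.filter (fun v : Equiv.Perm (Fin n) => IsConj v w)).card : ℂ) =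
        (n.factorial : ℂ) := by
    rw [Subgroup.nat_card_centralizer_nat_card_stabilizer, horb, mul_comm, ← Nat.cast_mul,
      ← Nat.card_prod, Nat.card_congr (MulAction.orbitProdStabilizerEquivGroup
        (ConjAct (Equiv.Perm (Fin n))) w)]
    have : Nat.card (ConjAct (Equiv.Perm (Fin n))) = n.factorial := by
      rw [Nat.card_congr (ConjAct.ofConjAct (G := Equiv.Perm (Fin n))).toEquiv]
      simp [Nat.card_eq_fintype_card, Fintype.card_perm]
    rw [this]
  have hn : (n.factorial : ℂ) ≠ 0 := by exact_mod_cast n.factorial_ne_zero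
  calc _ = (Nat.card (Subgroup.centralizer {w}) *
      ((Finset.univ.filter (fun v : Equiv.Perm (Fin n) => IsConj v w)).card : ℂ)) *
        (n.factorial : ℂ)⁻¹ * f w := by ring
    _ = f w := by rw [hcard, mul_inv_cancel₀ hn, one_mul]

/-- The complete homogeneous symmetric function `h_n = ch(1_{S_n})`. -/
def hsym (n : ℕ) : Symm := ch (fun _ : Equiv.Perm (Fin n) => 1)

/-- The elementary symmetric function `e_n = ch(ε_n)`. -/
def esym (n : ℕ) : Symm := ch (signChar n)

/-- `e_k` for an integer index, with `e_k = 0` for `k < 0`. -/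
def esymZ (k : ℤ) : Symm := if 0 ≤ k then esym k.toNat else 0

/-- Plethysm `f[g]`: the algebra homomorphism in `f` sending `p_k` to `p_k[g]`, where
`g ↦ p_k[g]` is the algebra homomorphism sending `p_j` to `p_{kj}`. -/
def plethysm (f g : Symm) : Symm :=
  MvPolynomial.aeval
    (fun k : ℕ+ => MvPolynomial.aeval (fun j : ℕ+ => (MvPolynomial.X (k * j) : Symm)) g) f

/-- The Lie character `Lie_{(n)}`: the induction to `S_n` of the linear character `θ` of the cyclic
subgroup `C_n = ⟨c⟩`, where `c` is an `n`-cycle. -/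
def lieCyclic {n : ℕ} (c : Equiv.Perm (Fin n)) (θ : Subgroup.zpowers c →* ℂˣ) :
    Equiv.Perm (Fin n) → ℂ :=
  letI : Fintype (Subgroup.zpowers c) := Fintype.ofFinite _
  induce (Subgroup.zpowers c).subtype (fun h => (θ h : ℂ))

section HigherLie

variable (c : ∀ n : ℕ, Equiv.Perm (Fin n)) (θ : ∀ n : ℕ, Subgroup.zpowers (c n) →* ℂˣ)

/-- `ℓ_n = ch(Lie_{(n)})`. -/
def ell (n : ℕ) : Symm := ch (lieCyclic (c n) (θ n))

/-- `π_n = ch(ε_n ⊗ Lie_{(n)})`. -/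
def pie (n : ℕ) : Symm := ch (fun w => signChar n w * lieCyclic (c n) (θ n) w)

/-- The higher Lie character `Lie_λ`, with `ch(Lie_λ) = ∏_{j ≥ 1} h_{m_j}[ℓ_j]`
for `λ = 1^{m_1} 2^{m_2} ⋯`. -/
def lieChar {n : ℕ} (lam : n.Partition) : Equiv.Perm (Fin n) → ℂ :=
  chInv n (∏ j ∈ Finset.Icc 1 n, plethysm (hsym (lam.parts.count j)) (ell c θ j))

/-- The character `W_λ`, with
`ch(W_λ) = ∏_{j odd} h_{m_j}[π_j] ∏_{j even} e_{m_j}[π_j]` for `λ = 1^{m_1} 2^{m_2} ⋯`. -/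
def whitneyChar {n : ℕ} (lam : n.Partition) : Equiv.Perm (Fin n) → ℂ :=
  chInv n (∏ j ∈ Finset.Icc 1 n,
    if Odd j then plethysm (hsym (lam.parts.count j)) (pie c θ j)
    else plethysm (esym (lam.parts.count j)) (pie c θ j))

/-- The rank `∑_k (λ_k - 1)` of a partition. -/
def rank {n : ℕ} (lam : n.Partition) : ℕ := (lam.parts.map (fun k => k - 1)).sum

/-- The partitions of `n` of rank `i` with no part equal to `1`. -/
def derangementPartitions (n i : ℕ) : Finset n.Partition :=
  Finset.univ.filter (fun lam => 1 ∉ lam.parts ∧ rank lam = i)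

/-- `Lie-hat_n^i`, the sum of `Lie_λ` over partitions `λ` of `n` of rank `i` without parts `1`. -/
def lieHatGraded (n i : ℕ) : Equiv.Perm (Fin n) → ℂ :=
  ∑ lam ∈ derangementPartitions n i, lieChar c θ lam

/-- `W-hat_n^i`, the sum of `W_λ` over partitions `λ` of `n` of rank `i` without parts `1`. -/
def whitneyHatGraded (n i : ℕ) : Equiv.Perm (Fin n) → ℂ :=
  ∑ lam ∈ derangementPartitions n i, whitneyChar c θ lam

/-- `Lie-hat_n = ∑_i Lie-hat_n^i` (the rank of a partition of `n` is at most `n`). -/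
def lieHat (n : ℕ) : Equiv.Perm (Fin n) → ℂ :=
  ∑ i ∈ Finset.range (n + 1), lieHatGraded c θ n i

/-- `W-hat_n = ∑_i W-hat_n^i` (the rank of a partition of `n` is at most `n`). -/
def whitneyHat (n : ℕ) : Equiv.Perm (Fin n) → ℂ :=
  ∑ i ∈ Finset.range (n + 1), whitneyHatGraded c θ n i

end HigherLie

/-- The `i`-th part (`i = 1, 2, …`) of the conjugate partition: the number of parts `≥ i`. -/
def conjPart {n : ℕ} (lam : n.Partition) (i : ℕ) : ℕ := lam.parts.countP (fun k => i ≤ k)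

/-- The Schur function `s_λ = det(e_{λᵗ_i - i + j})_{i,j = 1, …, λ_1}`; here `λ_1` is the
largest part of `λ`. -/
def schur {n : ℕ} (lam : n.Partition) : Symm :=
  Matrix.det (Matrix.of fun i j : Fin (lam.parts.sup) =>
    esymZ ((conjPart lam (i.val + 1) : ℤ) - (i.val + 1 : ℤ) + (j.val + 1 : ℤ)))

/-- The irreducible character `χ^λ` of `S_n`, i.e. the class function with `ch(χ^λ) = s_λ`
(so that `χ^{(n)}` is trivial and `χ^{(1^n)}` is the sign character). -/
def irrChar {n : ℕ} (lam : n.Partition) : Equiv.Perm (Fin n) → ℂ := chInv n (schur lam)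

/-- The partition `(3, 1^{n-3})` of `n`. -/
def hookThree (n : ℕ) (hn : 4 ≤ n) : n.Partition where
  parts := 3 ::ₘ Multiset.replicate (n - 3) 1
  parts_pos := by
    intro i hi
    rcases Multiset.mem_cons.1 hi with h | h
    · omega
    · have := Multiset.eq_of_mem_replicate h
      omega
  parts_sum := by simp; omega

/-- The partition `(2, 2, 1^{n-4})` of `n`. -/
def twoTwo (n : ℕ) (hn : 4 ≤ n) : n.Partition where
  parts := 2 ::ₘ 2 ::ₘ Multiset.replicate (n - 4) 1
  parts_pos := by
    intro i hi
    rcases Multiset.mem_cons.1 hi with h | h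
    · omega
    rcases Multiset.mem_cons.1 h with h | h
    · omega
    · have := Multiset.eq_of_mem_replicate h
      omega
  parts_sum := by simp; omega

/-- The virtual character `τ_n`: trivial for `n ≤ 3`, and
`χ^{(3,1^{n-3})} - χ^{(2,2,1^{n-4})}` for `n ≥ 4`. -/
def tau (n : ℕ) : Equiv.Perm (Fin n) → ℂ :=
  if hn : 4 ≤ n then irrChar (hookThree n hn) - irrChar (twoTwo n hn) else 1

end DerangementChar

end

noncomputable section

namespace DerangementChar

/-! Under `ch`, induction from S_n to S_{n+1} is multiplication by p_1. Both recurrences therefore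
say what the generating series L = ∑ ch(Lie-hat_n) t^n and W = ∑ ch(W-hat_n) t^n become after
multiplication by 1 - p_1 t.

A sum over all partitions of products indexed by multiplicities is a product over j of series in
t^j, and excluding parts 1 removes the factor j = 1. Products and plethysms become tractable under t
d/dt log: the series ∑ h_m[g] t^m has logarithmic derivative ∑ p_k[g] t^k, and e_m only adds signs.
Since j ℓ_j = ∑_{d ∣ j} μ(d) p_d^{j/d}, a Möbius cancellation (`sum_adams_ell`) leaves only powers
of p_1, so the full Lie product is 1/(1 - p_1 t). In the Whitney case the signs leave exactly one
more contribution, from p_2 (`sum_adams_pie`), and the full product is (1 + p_2 t^2)/(1 - p_1 t).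

The removed factor is ∑ h_n t^n, whose inverse is ∑ (-1)^n e_n t^n. Hence (1 - p_1 t) L = ∑ (-1)^n
e_n t^n, and (1 - p_1 t) W is the same series times 1 + p_2 t^2, with coefficients (-1)^n (e_n + p_2
e_{n-2}). These two equations are `one_sub_mul_lieSeries` and `one_sub_mul_whitneySeries`; they are
proved by comparing logarithmic derivatives and constant terms (`eq_of_eulerOp_eq_mul`). Finally the
dual Jacobi–Trudi determinants identify e_n + p_2 e_{n-2} with ch(τ_n) (`tau_eq`). -/

open PowerSeries in
/-- The Euler operator `t d/dt` on power series. -/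
def eulerOp (R : Type*) [CommRing R] : Derivation R R⟦X⟧ R⟦X⟧ :=
  (X : R⟦X⟧) • PowerSeries.derivative R

/-! ### Logarithmic derivatives and partition generating series. -/

section PowerSeriesLemmas

open PowerSeries Finset

variable {R : Type*} [CommRing R]

theorem coeff_eulerOp (f : R⟦X⟧) (n : ℕ) : coeff n (eulerOp R f) = n * coeff n f := by
  have : eulerOp R f = X * PowerSeries.derivative R f := rfl
  rw [this]
  cases n with
  | zero => simp
  | succ n => rw [coeff_succ_X_mul, coeff_derivative]; push_cast; ring

theorem eulerOp_X_pow (m : ℕ) : eulerOp R (X ^ m) = (m : R⟦X⟧) * X ^ m := by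
  ext n
  have : (m : R⟦X⟧) = C (m : R) := by simp
  rw [coeff_eulerOp, this, coeff_C_mul, coeff_X_pow]
  split_ifs with h
  · rw [h]
  · simp

theorem eulerOp_map {S : Type*} [CommRing S] (φ : R →+* S) (f : R⟦X⟧) :
    eulerOp S (PowerSeries.map φ f) = PowerSeries.map φ (eulerOp R f) := by
  ext n
  simp [coeff_eulerOp]

theorem eulerOp_expand (j : ℕ) (hj : j ≠ 0) (f : R⟦X⟧) :
    eulerOp R (expand j hj f) = j • expand j hj (eulerOp R f) := by
  ext n
  rw [coeff_eulerOp, map_nsmul, coeff_expand, coeff_expand, coeff_eulerOp]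
  split_ifs with h
  · obtain ⟨k, rfl⟩ := h
    rw [Nat.mul_div_cancel_left _ (Nat.pos_of_ne_zero hj)]
    push_cast
    rw [nsmul_eq_mul, mul_assoc]
  · simp

/-- A power series with given constant term and logarithmic derivative is unique. -/
theorem eq_of_eulerOp_eq_mul [IsDomain R] [CharZero R] {A B G : R⟦X⟧} (hG : coeff 0 G = 0)
    (hA : eulerOp R A = A * G) (hB : eulerOp R B = B * G) (h0 : coeff 0 A = coeff 0 B) :
    A = B := by
  ext n
  induction n using Nat.strong_induction_on with
  | _ n ih =>
    rcases Nat.eq_zero_or_pos n with rfl | hn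
    · exact h0
    · have hA' := congrArg (coeff n) hA
      have hB' := congrArg (coeff n) hB
      rw [coeff_eulerOp, coeff_mul] at hA' hB'
      have hn' : (n : R) ≠ 0 := by exact_mod_cast hn.ne'
      apply mul_left_cancel₀ hn'
      rw [hA', hB']
      refine sum_congr rfl fun x hx => ?_
      rw [HasAntidiagonal.mem_antidiagonal] at hx
      -- As G has no constant term, n times the n-th coefficient involves only earlier coefficients.
      rcases Nat.eq_zero_or_pos x.2 with h | h
      · rw [h, hG, mul_zero, mul_zero]
      · rw [ih x.1 (by omega)]

theorem eulerOp_prod {ι : Type*} (s : Finset ι) (A G : ι → R⟦X⟧)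
    (h : ∀ i ∈ s, eulerOp R (A i) = A i * G i) :
    eulerOp R (∏ i ∈ s, A i) = (∏ i ∈ s, A i) * ∑ i ∈ s, G i := by
  classical
  induction s using Finset.induction_on with
  | empty => simp
  | insert a s ha ih =>
    rw [prod_insert ha, sum_insert ha, Derivation.leibniz, ih fun i hi => h i (mem_insert_of_mem hi),
      h a (mem_insert_self a s)]
    simp only [smul_eq_mul]
    ring

/-- `A(t) ↦ A(t^j)`, with value `1` at `j = 0`. -/
def expandOrOne (j : ℕ) (A : R⟦X⟧) : R⟦X⟧ := if hj : j ≠ 0 then expand j hj A else 1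

theorem expandOrOne_of_ne_zero {j : ℕ} (hj : j ≠ 0) (A : R⟦X⟧) :
    expandOrOne j A = expand j hj A := dif_pos hj

/-- A partition corresponds to the function j ↦ j m_j, which picks one term from each A_j(t^j).
Constant terms equal to 1 make the product insensitive to the cutoff N ≥ n, so one finite product
serves all degrees up to N. -/
theorem sum_partition_eq_coeff_prod (A : ℕ → R⟦X⟧) (hA : ∀ j, coeff 0 (A j) = 1) {n N : ℕ}
    (hn : n ≤ N) :
    ∑ p : n.Partition, ∏ j ∈ Icc 1 n, coeff (p.parts.count j) (A j) =
      coeff n (∏ j ∈ Icc 1 N, expandOrOne j (A j)) := by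
  rw [coeff_prod]
  have hsub : Icc 1 n ⊆ Icc 1 N := Icc_subset_Icc_right hn
  refine sum_of_injOn Nat.Partition.toFinsuppAntidiag
    (Nat.Partition.toFinsuppAntidiag_injective n).injOn ?_ ?_ ?_
  · intro p _
    exact mem_of_subset (finsuppAntidiag_mono hsub _) p.toFinsuppAntidiag_mem_finsuppAntidiag
  · intro g hg hg'
    rw [coe_univ, Set.image_univ] at hg'
    by_contra hne
    apply hg'
    -- A nonzero product of coefficients of the series in t^x forces x ∣ g x, so g comes from the
    -- partition with g x / x parts equal to x.
    have hdvd : ∀ x, x ∣ g x := by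
      intro x
      by_cases hx : x ∈ Icc 1 N
      · have h1 := fun h => hne (prod_eq_zero hx h)
        have hx0 : x ≠ 0 := by rw [mem_Icc] at hx; omega
        rw [expandOrOne_of_ne_zero hx0, coeff_expand] at h1
        by_contra h2
        exact h1 (if_neg h2)
      · have : g x = 0 := by
          by_contra h
          exact hx ((mem_finsuppAntidiag.mp hg).2 (by simpa using h))
        simp [this]
    have h0 : g 0 = 0 := by
      by_contra h
      have := (mem_finsuppAntidiag.mp hg).2 (show 0 ∈ g.support by simpa using h)
      simp at this
    refine ⟨Nat.Partition.mk (Finsupp.mk g.support (fun i ↦ g i / i) ?_).toMultiset ?_ ?_, ?_⟩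
    · intro i
      rw [Finsupp.mem_support_iff]
      obtain ⟨k, hk⟩ := hdvd i
      rcases Nat.eq_zero_or_pos i with rfl | hi
      · simp [h0]
      · rw [hk, Nat.mul_div_cancel_left _ hi]
        simp [hi.ne']
    · intro i hi
      rcases Nat.eq_zero_or_pos i with rfl | hi'
      · simp [h0] at hi
      · exact hi'
    · obtain ⟨h1, h2⟩ := mem_finsuppAntidiag.mp hg
      refine Eq.trans ?_ h1
      suffices ∑ x ∈ g.support, g x / x * x = ∑ x ∈ Icc 1 N, g x by simpa [Finsupp.sum]
      apply sum_subset_zero_on_sdiff h2 (by simp)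
      exact fun x hx ↦ Nat.div_mul_cancel (hdvd x)
    · ext x
      simpa [Nat.Partition.toFinsuppAntidiag] using Nat.div_mul_cancel (hdvd x)
  · intro p _
    refine prod_subset_one_on_sdiff hsub (fun j hj => ?_) fun j hj => ?_
    · rw [mem_sdiff, mem_Icc, mem_Icc] at hj
      have hj0 : j ≠ 0 := by omega
      have hc : p.parts.count j = 0 := by
        rw [Multiset.count_eq_zero]
        intro h
        have := p.le_of_mem_parts h
        omega
      rw [expandOrOne_of_ne_zero hj0, show p.toFinsuppAntidiag j = j * p.parts.count j from
        mul_comm _ _, coeff_expand_mul, hc, hA]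
    · rw [mem_Icc] at hj
      have hj0 : j ≠ 0 := by omega
      rw [expandOrOne_of_ne_zero hj0, show p.toFinsuppAntidiag j = j * p.parts.count j from
        mul_comm _ _, coeff_expand_mul]

/-- The generating series `∑_λ ∏_j [t^{m_j(λ)}] A_j` over all partitions, with `m_j(λ)` the
multiplicity of `j` in `λ`. -/
def partitionSeries (A : ℕ → R⟦X⟧) : R⟦X⟧ :=
  PowerSeries.mk fun n => ∑ p : n.Partition, ∏ j ∈ Icc 1 n, coeff (p.parts.count j) (A j)

/-- The logarithmic derivative of a partition generating series. -/
theorem eulerOp_partitionSeries (A G : ℕ → R⟦X⟧) (hA : ∀ j, coeff 0 (A j) = 1)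
    (hG : ∀ j, coeff 0 (G j) = 0) (h : ∀ j, eulerOp R (A j) = A j * G j) :
    eulerOp R (partitionSeries A) = partitionSeries A *
      PowerSeries.mk fun n => ∑ j ∈ n.divisors, j * coeff (n / j) (G j) := by
  ext n
  -- The logarithmic derivative of A_j(t^j) is j G_j(t^j); the value at j = 0 is never used.
  set D : ℕ → R⟦X⟧ := fun j => if hj : j ≠ 0 then j • expand j hj (G j) else 0 with hD
  have hprod := eulerOp_prod (Icc 1 n) (fun j => expandOrOne j (A j)) D (by
    intro j hj
    have hj0 : j ≠ 0 := by rw [mem_Icc] at hj; omega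
    simp only [hD]
    rw [expandOrOne_of_ne_zero hj0, eulerOp_expand, h, map_mul, dif_pos hj0, mul_smul_comm])
  have hcoeff : ∀ m ≤ n, coeff m (partitionSeries A) =
      coeff m (∏ j ∈ Icc 1 n, expandOrOne j (A j)) := fun m hm => by
    rw [partitionSeries, coeff_mk, sum_partition_eq_coeff_prod A hA hm]
  have hD' : ∀ m ≤ n, coeff m (∑ j ∈ Icc 1 n, D j) =
      ∑ j ∈ m.divisors, j * coeff (m / j) (G j) := by
    intro m hm
    rw [map_sum]
    rcases Nat.eq_zero_or_pos m with rfl | hm0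
    · rw [Nat.divisors_zero, sum_empty]
      refine sum_eq_zero fun j hj => ?_
      have hj0 : j ≠ 0 := by rw [mem_Icc] at hj; omega
      simp only [hD]
      rw [dif_pos hj0, map_nsmul, coeff_expand, if_pos (dvd_zero j), Nat.zero_div, hG, smul_zero]
    · have hsub : m.divisors ⊆ Icc 1 n := fun j hj => by
        rw [mem_Icc]
        exact ⟨Nat.pos_of_mem_divisors hj, (Nat.divisor_le hj).trans hm⟩
      symm
      refine sum_subset_zero_on_sdiff hsub (fun j hj => ?_) fun j hj => ?_
      · rw [mem_sdiff, Nat.mem_divisors, mem_Icc] at hj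
        have hj0 : j ≠ 0 := by omega
        have hjm : ¬ j ∣ m := fun h => hj.2 ⟨h, hm0.ne'⟩
        simp only [hD]
        rw [dif_pos hj0, map_nsmul, coeff_expand, if_neg hjm, smul_zero]
      · have hj0 : j ≠ 0 := (Nat.pos_of_mem_divisors hj).ne'
        simp only [hD]
        rw [dif_pos hj0, map_nsmul, coeff_expand, if_pos (Nat.dvd_of_mem_divisors hj),
          nsmul_eq_mul]
  rw [coeff_eulerOp, hcoeff n le_rfl, ← coeff_eulerOp, hprod, coeff_mul, coeff_mul]
  refine sum_congr rfl fun x hx => ?_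
  rw [HasAntidiagonal.mem_antidiagonal] at hx
  rw [hcoeff x.1 (by omega), hD' x.2 (by omega), coeff_mk]

end PowerSeriesLemmas

/-! ### Cycle types as exponent vectors, and the numbers z_λ. -/

section CycleTypeMonomials

open MvPolynomial

theorem typeExp_zero : typeExp 0 = 0 := by simp [typeExp]

theorem typeExp_add (s t : Multiset ℕ) : typeExp (s + t) = typeExp s + typeExp t := by
  simp [typeExp]

theorem typeExp_cons (k : ℕ) (s : Multiset ℕ) :
    typeExp (k ::ₘ s) = Finsupp.single k.toPNat' 1 + typeExp s := by
  rw [← Multiset.singleton_add, typeExp_add]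
  simp [typeExp]

theorem typeExp_replicate (m k : ℕ) :
    typeExp (Multiset.replicate m k) = Finsupp.single k.toPNat' m := by
  induction m with
  | zero => simp [typeExp_zero]
  | succ m ih => rw [Multiset.replicate_succ, typeExp_cons, ih, ← Finsupp.single_add, add_comm]

/-- The weight `∑ k d_k` of an exponent vector. -/
def expWeight (d : ℕ+ →₀ ℕ) : ℕ := Finsupp.weight (fun k : ℕ+ => (k : ℕ)) d

theorem expWeight_add (d e : ℕ+ →₀ ℕ) : expWeight (d + e) = expWeight d + expWeight e :=
  map_add _ _ _

theorem expWeight_single (k : ℕ+) (m : ℕ) : expWeight (Finsupp.single k m) = m * k := by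
  simp [expWeight, Finsupp.weight_single]

theorem expWeight_typeExp (s : Multiset ℕ) (hs : ∀ k ∈ s, 0 < k) :
    expWeight (typeExp s) = s.sum := by
  induction s using Multiset.induction_on with
  | empty => simp [typeExp_zero, expWeight]
  | cons a s ih =>
    rw [typeExp_cons, expWeight_add, expWeight_single, ih fun k hk => hs k (Multiset.mem_cons_of_mem hk),
      Multiset.sum_cons, Nat.toPNat'_coe, if_pos (hs a (Multiset.mem_cons_self a s)), one_mul]

theorem expWeight_partition {n : ℕ} (w : Equiv.Perm (Fin n)) :
    expWeight (typeExp w.partition.parts) = n := by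
  rw [expWeight_typeExp _ fun k hk => w.partition.parts_pos hk, w.partition.parts_sum,
    Fintype.card_fin]

/-- Every exponent vector of weight `n` is the cycle type of a permutation. -/
theorem exists_perm_typeExp_eq {n : ℕ} (d : ℕ+ →₀ ℕ) (hd : expWeight d = n) :
    ∃ w : Equiv.Perm (Fin n), typeExp w.partition.parts = d := by
  set s : Multiset ℕ := (Finsupp.toMultiset d).map (fun k : ℕ+ => (k : ℕ)) with hs
  have hpos : ∀ k ∈ s, 0 < k := by
    intro k hk
    rw [hs, Multiset.mem_map] at hk
    obtain ⟨a, -, rfl⟩ := hk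
    exact a.pos
  have hsd : typeExp s = d := by
    rw [typeExp, hs, Multiset.map_map]
    have : (Nat.toPNat' ∘ fun k : ℕ+ => (k : ℕ)) = id := by
      funext k
      exact PNat.coe_toPNat' k
    rw [this, Multiset.map_id, Finsupp.toMultiset_toFinsupp]
  have hsum : s.sum = n := by rw [← expWeight_typeExp s hpos, hsd, hd]
  have hsplit := Multiset.filter_add_not (fun k => 2 ≤ k) s
  -- `cycleType` omits fixed points, so the parts equal to 1 are split off and recovered from the
  -- total n.
  have hone : s.filter (fun k => ¬ 2 ≤ k) =
      Multiset.replicate (s.filter (fun k => ¬ 2 ≤ k)).card 1 := by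
    rw [Multiset.eq_replicate]
    refine ⟨rfl, fun b hb => ?_⟩
    rw [Multiset.mem_filter] at hb
    have := hpos b hb.1
    omega
  have hsum' : (s.filter (fun k => 2 ≤ k)).sum + (s.filter (fun k => ¬ 2 ≤ k)).card = n := by
    rw [← hsum]
    conv_rhs => rw [← hsplit, Multiset.sum_add, hone]
    simp
  obtain ⟨w, hw⟩ := (Equiv.Perm.exists_with_cycleType_iff (Fin n)
    (m := s.filter (fun k => 2 ≤ k))).2 ⟨by rw [Fintype.card_fin]; omega,
      fun a ha => (Multiset.mem_filter.1 ha).2⟩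
  refine ⟨w, ?_⟩
  rw [Equiv.Perm.parts_partition, ← Equiv.Perm.sum_cycleType, hw, Fintype.card_fin, ← hsd]
  conv_rhs => rw [← hsplit, hone]
  rw [← hsum', Nat.add_sub_cancel_left]

/-- The number `z_λ = ∏ k^{m_k} m_k!`. -/
def zNum (d : ℕ+ →₀ ℕ) : ℕ := d.prod fun k m => (k : ℕ) ^ m * m.factorial

theorem zNum_ne_zero (d : ℕ+ →₀ ℕ) : zNum d ≠ 0 :=
  Finset.prod_ne_zero_iff.2 fun k _ =>
    mul_ne_zero (pow_ne_zero _ k.ne_zero) (Nat.factorial_ne_zero _)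

theorem zNum_eq_mul_erase (k : ℕ+) (d : ℕ+ →₀ ℕ) :
    zNum d = (k : ℕ) ^ d k * (d k).factorial * zNum (d.erase k) :=
  (Finsupp.mul_prod_erase' d k _ fun _ => by simp).symm

theorem zNum_eq_mul_sub_single (k : ℕ+) (d : ℕ+ →₀ ℕ) (hk : d k ≠ 0) :
    zNum d = k * d k * zNum (d - Finsupp.single k 1) := by
  have he : (d - Finsupp.single k 1).erase k = d.erase k := by
    ext j
    by_cases hj : j = k
    · simp [hj]
    · simp [Finsupp.erase_ne hj, Ne.symm hj]
  rw [zNum_eq_mul_erase k d, zNum_eq_mul_erase k (d - _), he]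
  obtain ⟨m, hm⟩ := Nat.exists_eq_succ_of_ne_zero hk
  simp only [Finsupp.tsub_apply, Finsupp.single_eq_same, hm, Nat.succ_eq_add_one,
    Nat.add_sub_cancel, Nat.factorial_succ]
  ring

/-- The known centralizer formula treats fixed points apart from the nontrivial cycles; their
exponent vectors have disjoint supports, so the two factors combine into z_λ. -/
theorem nat_card_centralizer_eq_zNum {n : ℕ} (w : Equiv.Perm (Fin n)) :
    Nat.card (Subgroup.centralizer {w}) = zNum (typeExp w.partition.parts) := by
  have hct : ∀ k ∈ w.cycleType, 2 ≤ k := fun k hk => Equiv.Perm.two_le_of_mem_cycleType hk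
  have hinj : Set.InjOn Nat.toPNat' (w.cycleType.toFinset : Set ℕ) := by
    intro a ha b hb hab
    simp only [Finset.mem_coe, Multiset.mem_toFinset] at ha hb
    have := congrArg (fun k : ℕ+ => (k : ℕ)) hab
    simpa [Nat.toPNat'_coe, show 0 < a by linarith [hct a ha],
      show 0 < b by linarith [hct b hb]] using this
  have hcount : ∀ k ∈ w.cycleType,
      (w.cycleType.map Nat.toPNat').count k.toPNat' = w.cycleType.count k := fun k hk =>
    Multiset.count_map_eq_count _ _ (by
      intro a ha b hb
      exact hinj (by simpa using ha) (by simpa using hb)) k hk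
  have hdisj : Disjoint (typeExp w.cycleType).support
      (Finsupp.single (1 : ℕ).toPNat' (Fintype.card (Fin n) - w.support.card)).support := by
    refine Finset.disjoint_of_subset_right Finsupp.support_single_subset ?_
    rw [Finset.disjoint_singleton_right]
    intro h
    rw [typeExp, Multiset.toFinsupp_support, Multiset.mem_toFinset, Multiset.mem_map] at h
    obtain ⟨a, ha, ha'⟩ := h
    have := congrArg (fun k : ℕ+ => (k : ℕ)) ha'
    have h2 := hct a ha
    rw [Nat.toPNat'_coe, if_pos (by omega)] at this
    simp at this
    omega
  rw [Equiv.Perm.nat_card_centralizer, Equiv.Perm.parts_partition, typeExp_add,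
    typeExp_replicate, zNum, Finsupp.prod_add_index_of_disjoint hdisj, Finsupp.prod_single_index
    (by simp), Equiv.Perm.sum_cycleType, mul_assoc, mul_comm]
  congr 1
  · rw [typeExp, Finsupp.prod, Multiset.toFinsupp_support, Multiset.toFinset_map,
      Finset.prod_image hinj, Finset.prod_multiset_count, ← Finset.prod_mul_distrib]
    refine Finset.prod_congr rfl fun k hk => ?_
    rw [Multiset.mem_toFinset] at hk
    rw [Multiset.toFinsupp_apply, hcount k hk, Nat.toPNat'_coe, if_pos (by linarith [hct k hk])]
  · simp

theorem pCycle_eq_of_isConj {n : ℕ} {v w : Equiv.Perm (Fin n)} (h : IsConj v w) :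
    pCycle v = pCycle w := by
  rw [pCycle, pCycle, Equiv.Perm.partition_eq_of_isConj.1 h]

end CycleTypeMonomials

/-! ### The Frobenius characteristic: induction, homogeneity, surjectivity. -/

section Characteristic

open MvPolynomial

/-- Class functions on `S_n`. -/
def IsClassFun {n : ℕ} (f : Equiv.Perm (Fin n) → ℂ) : Prop := ∀ x w, f (x * w * x⁻¹) = f w

theorem IsClassFun.add {n : ℕ} {f g : Equiv.Perm (Fin n) → ℂ} (hf : IsClassFun f)
    (hg : IsClassFun g) : IsClassFun (f + g) := fun x w => by
  simp only [Pi.add_apply, hf x w, hg x w]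

theorem IsClassFun.smul {n : ℕ} {f : Equiv.Perm (Fin n) → ℂ} (a : ℂ) (hf : IsClassFun f) :
    IsClassFun (a • f) := fun x w => by
  simp only [Pi.smul_apply, hf x w]

theorem isClassFun_signChar (n : ℕ) : IsClassFun (signChar n) := fun x w => by
  simp only [signChar, map_mul, map_inv]
  rw [mul_comm (Equiv.Perm.sign x), mul_inv_cancel_right]

theorem isClassFun_induce {n : ℕ} {H : Type*} [Group H] [Fintype H]
    (φ : H →* Equiv.Perm (Fin n)) (χ : H → ℂ) : IsClassFun (induce φ χ) := fun x w => by
  unfold induce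
  congr 1
  refine Fintype.sum_equiv (Equiv.mulLeft x⁻¹) _ _ fun y => ?_
  refine Finset.sum_congr rfl fun h _ => ?_
  have : y⁻¹ * (x * w * x⁻¹) * y = (x⁻¹ * y)⁻¹ * w * (x⁻¹ * y) := by group
  rw [this]
  rfl

theorem ch_add {n : ℕ} (f g : Equiv.Perm (Fin n) → ℂ) : ch (f + g) = ch f + ch g := by
  simp only [ch, Pi.add_apply, add_smul, Finset.sum_add_distrib, smul_add]

theorem ch_smul {n : ℕ} (a : ℂ) (f : Equiv.Perm (Fin n) → ℂ) : ch (a • f) = a • ch f := by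
  simp only [ch, Pi.smul_apply, smul_eq_mul, mul_smul, ← Finset.smul_sum]
  rw [smul_comm]

theorem chInv_add (n : ℕ) (F G : Symm) : chInv n (F + G) = chInv n F + chInv n G := by
  funext w
  simp [chInv, mul_add]

theorem chInv_sub (n : ℕ) (F G : Symm) : chInv n (F - G) = chInv n F - chInv n G := by
  funext w
  simp [chInv, mul_sub]

theorem chInv_sum {ι : Type*} (n : ℕ) (s : Finset ι) (F : ι → Symm) :
    chInv n (∑ i ∈ s, F i) = ∑ i ∈ s, chInv n (F i) := by
  funext w
  simp [chInv, Finset.mul_sum, MvPolynomial.coeff_sum]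

/-- In Frobenius' formula a pair (x, h) is met only by w = x φ(h) x⁻¹, which has the cycle type of
φ(h); the sum over x then contributes n!, cancelling the normalization. -/
theorem ch_induce {n : ℕ} {H : Type*} [Group H] [Fintype H]
    (φ : H →* Equiv.Perm (Fin n)) (χ : H → ℂ) :
    ch (induce φ χ) = (Fintype.card H : ℂ)⁻¹ • ∑ h : H, χ h • pCycle (φ h) := by
  have key : ∑ w : Equiv.Perm (Fin n), induce φ χ w • pCycle w =
      (n.factorial : ℂ) • (Fintype.card H : ℂ)⁻¹ • ∑ h : H, χ h • pCycle (φ h) := by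
    simp only [induce, mul_smul, ← Finset.smul_sum, Finset.sum_smul]
    rw [smul_comm (n.factorial : ℂ)]
    congr 1
    rw [Finset.sum_comm]
    trans ∑ _x : Equiv.Perm (Fin n), ∑ h : H, χ h • pCycle (φ h)
    · refine Finset.sum_congr rfl fun x _ => ?_
      rw [Finset.sum_comm]
      refine Finset.sum_congr rfl fun h _ => ?_
      rw [Finset.sum_eq_single (x * φ h * x⁻¹)]
      · rw [if_pos (by group)]
        congr 1
        exact pCycle_eq_of_isConj (isConj_iff.2 ⟨x, rfl⟩ : IsConj (φ h) _).symm
      · intro w _ hw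
        rw [if_neg, zero_smul]
        intro h'
        apply hw
        rw [h']
        group
      · intro h'
        exact absurd (Finset.mem_univ _) h'
    · rw [Finset.sum_const, Finset.card_univ, Fintype.card_perm, Fintype.card_fin,
        ← Nat.cast_smul_eq_nsmul ℂ]
  have hn : (n.factorial : ℂ) ≠ 0 := by exact_mod_cast n.factorial_ne_zero
  rw [ch, key, inv_smul_smul₀ hn]

theorem pCycle_inclS {n : ℕ} (w : Equiv.Perm (Fin n)) :
    pCycle (inclS n w) = X 1 * pCycle w := by
  have hct : (inclS n w).cycleType = w.cycleType := by
    rw [inclS, Equiv.Perm.viaEmbeddingHom_apply, Equiv.Perm.viaEmbedding]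
    classical
    convert Equiv.Perm.cycleType_extendDomain _ 
  have hle : w.support.card ≤ n := by simpa using w.support.card_le_univ
  have hp : (inclS n w).partition.parts = 1 ::ₘ w.partition.parts := by
    rw [Equiv.Perm.parts_partition, Equiv.Perm.parts_partition, ← Equiv.Perm.sum_cycleType, hct,
      Equiv.Perm.sum_cycleType, Fintype.card_fin, Fintype.card_fin, Nat.sub_add_comm hle,
      Multiset.replicate_succ, Multiset.add_cons]
  rw [pCycle, pCycle, hp, typeExp_cons, X, monomial_mul, one_mul]
  rfl

theorem ch_indS {n : ℕ} (f : Equiv.Perm (Fin n) → ℂ) : ch (indS f) = X 1 * ch f := by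
  rw [indS, ch_induce, ch, mul_smul_comm, Finset.mul_sum, Fintype.card_perm, Fintype.card_fin]
  congr 1
  refine Finset.sum_congr rfl fun w _ => ?_
  rw [pCycle_inclS, mul_smul_comm]

/-- Homogeneity of degree `n`, the variable `p_k` having degree `k`. -/
abbrev IsHomog (F : Symm) (n : ℕ) : Prop :=
  IsWeightedHomogeneous (fun k : ℕ+ => (k : ℕ)) F n

theorem isHomog_ch {n : ℕ} (f : Equiv.Perm (Fin n) → ℂ) : IsHomog (ch f) n := by
  rw [IsHomog, ← mem_weightedHomogeneousSubmodule]
  refine Submodule.smul_mem _ _ (Submodule.sum_mem _ fun w _ => Submodule.smul_mem _ _ ?_)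
  exact isWeightedHomogeneous_monomial _ _ _ (expWeight_partition w)

/-- The witness is the indicator of the conjugacy class of w, scaled by n! over the size of the
class. -/
theorem exists_ch_eq_pCycle {n : ℕ} (w : Equiv.Perm (Fin n)) :
    ∃ f : Equiv.Perm (Fin n) → ℂ, IsClassFun f ∧ ch f = pCycle w := by
  classical
  set s := (Finset.univ.filter (fun v : Equiv.Perm (Fin n) => IsConj v w)) with hs
  have hcard : (s.card : ℂ) ≠ 0 := by
    have : s.Nonempty := ⟨w, Finset.mem_filter.2 ⟨Finset.mem_univ _, IsConj.refl w⟩⟩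
    exact_mod_cast this.card_pos.ne'
  have hn : (n.factorial : ℂ) ≠ 0 := by exact_mod_cast n.factorial_ne_zero
  refine ⟨((n.factorial : ℂ) * (s.card : ℂ)⁻¹) • fun v => if IsConj v w then 1 else 0,
    IsClassFun.smul _ fun x v => ?_, ?_⟩
  · have : IsConj (x * v * x⁻¹) w ↔ IsConj v w :=
      ⟨fun h => (isConj_iff.2 ⟨x, rfl⟩ : IsConj v _).trans h,
        fun h => (isConj_iff.2 ⟨x, rfl⟩ : IsConj v (x * v * x⁻¹)).symm.trans h⟩
    simp only [this]
  · have : ∑ v : Equiv.Perm (Fin n), (if IsConj v w then (1 : ℂ) else 0) • pCycle v =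
        (s.card : ℂ) • pCycle w := by
      rw [Nat.cast_smul_eq_nsmul ℂ, ← Finset.sum_const, hs, Finset.sum_filter]
      refine Finset.sum_congr rfl fun v _ => ?_
      split_ifs with h
      · rw [one_smul, pCycle_eq_of_isConj h]
      · rw [zero_smul]
    rw [ch_smul, ch, this, smul_comm, smul_smul, smul_smul]
    have : (n.factorial : ℂ)⁻¹ * ((n.factorial : ℂ) * (s.card : ℂ)⁻¹) * s.card = 1 := by
      field_simp
    rw [this, one_smul]

/-- The Frobenius characteristic maps onto the symmetric functions of degree `n`. -/
theorem exists_ch_eq {n : ℕ} {F : Symm} (hF : IsHomog F n) : ∃ f : Equiv.Perm (Fin n) → ℂ, IsClassFun f ∧ ch f = F := by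
  let V : Submodule ℂ Symm :=
    { carrier := {F | ∃ f : Equiv.Perm (Fin n) → ℂ, IsClassFun f ∧ ch f = F}
      add_mem' := by
        rintro _ _ ⟨f, hf, rfl⟩ ⟨g, hg, rfl⟩
        exact ⟨f + g, hf.add hg, ch_add f g⟩
      zero_mem' := ⟨0, fun _ _ => rfl, by simp [ch]⟩
      smul_mem' := by
        rintro a _ ⟨f, hf, rfl⟩
        exact ⟨a • f, hf.smul a, ch_smul a f⟩ }
  change F ∈ V
  rw [F.as_sum]
  refine Submodule.sum_mem _ fun d hd => ?_
  obtain ⟨w, hw⟩ := exists_perm_typeExp_eq d (hF (mem_support_iff.1 hd))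
  have : monomial d (F.coeff d) = F.coeff d • pCycle w := by
    rw [pCycle, hw, smul_monomial, smul_eq_mul, mul_one]
  rw [this]
  exact Submodule.smul_mem _ _ (exists_ch_eq_pCycle w)

theorem isClassFun_chInv {n : ℕ} {F : Symm} (hF : IsHomog F n) : IsClassFun (chInv n F) := by
  obtain ⟨f, hf, rfl⟩ := exists_ch_eq hF
  rwa [chInv_ch f hf]

theorem ch_chInv {n : ℕ} {F : Symm} (hF : IsHomog F n) : ch (chInv n F) = F := by
  obtain ⟨f, hf, rfl⟩ := exists_ch_eq hF
  rw [chInv_ch f hf]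

end Characteristic

/-! ### Newton's identities for h_n and e_n. -/

section Newton

open MvPolynomial

/-- The power sum `p_k` for a natural number `k`, with `p_0 = 0`. -/
def psumN (k : ℕ) : Symm := if k = 0 then 0 else X k.toPNat'

theorem psumN_zero : psumN 0 = 0 := if_pos rfl

theorem psumN_of_pos {k : ℕ} (hk : 0 < k) : psumN k = X k.toPNat' := if_neg hk.ne'

theorem psumN_coe (k : ℕ+) : psumN k = X k := by
  rw [psumN_of_pos k.pos, PNat.coe_toPNat']

/-- In weight n this is `chInv_ch` for the constant function 1: coefficient times centralizer order
is 1. -/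
theorem coeff_hsym (n : ℕ) (d : ℕ+ →₀ ℕ) :
    (hsym n).coeff d = if expWeight d = n then (zNum d : ℂ)⁻¹ else 0 := by
  split_ifs with h
  · obtain ⟨w, rfl⟩ := exists_perm_typeExp_eq d h
    have h1 := congrFun (chInv_ch (fun _ : Equiv.Perm (Fin n) => (1 : ℂ)) fun _ _ => rfl) w
    rw [chInv, nat_card_centralizer_eq_zNum] at h1
    exact eq_inv_of_mul_eq_one_right h1
  · exact (isHomog_ch _).coeff_eq_zero d h

theorem hsym_zero : hsym 0 = 1 := by
  have : pCycle (1 : Equiv.Perm (Fin 0)) = 1 := by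
    rw [pCycle]
    have : (1 : Equiv.Perm (Fin 0)).partition.parts = 0 := by
      rw [Equiv.Perm.parts_partition]
      simp
    rw [this, typeExp_zero]
    rfl
  simp [hsym, ch, this]

theorem expWeight_sub_single (d : ℕ+ →₀ ℕ) (k : ℕ+) (hk : k ∈ d.support) :
    expWeight (d - Finsupp.single k 1) + k = expWeight d := by
  have h : d - Finsupp.single k 1 + Finsupp.single k 1 = d :=
    tsub_add_cancel_of_le (by
      rw [Finsupp.single_le_iff]
      exact Nat.one_le_iff_ne_zero.2 (Finsupp.mem_support_iff.1 hk))
  conv_rhs => rw [← h, expWeight_add, expWeight_single, one_mul]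

/-- Newton's identity `n h_n = ∑ h_{n-k} p_k` as a differential equation. -/
theorem eulerOp_hsym : eulerOp Symm (PowerSeries.mk hsym) =
    PowerSeries.mk hsym * PowerSeries.mk psumN := by
  classical
  ext n d
  rw [coeff_eulerOp, PowerSeries.coeff_mul, MvPolynomial.coeff_sum]
  simp only [PowerSeries.coeff_mk]
  have hterm : ∀ x : ℕ × ℕ, (hsym x.1 * psumN x.2).coeff d =
      if 0 < x.2 ∧ x.2.toPNat' ∈ d.support ∧ expWeight d = x.1 + x.2 then
        (zNum (d - Finsupp.single x.2.toPNat' 1) : ℂ)⁻¹ else 0 := by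
    rintro ⟨a, b⟩
    rcases Nat.eq_zero_or_pos b with rfl | hb
    · simp [psumN_zero]
    · simp only
      rw [psumN_of_pos hb, coeff_mul_X', coeff_hsym]
      by_cases hmem : b.toPNat' ∈ d.support
      · have hw := expWeight_sub_single d _ hmem
        rw [Nat.toPNat'_coe, if_pos hb] at hw
        rw [if_pos hmem]
        refine if_congr ?_ rfl rfl
        constructor
        · intro h
          exact ⟨hb, hmem, by omega⟩
        · rintro ⟨-, -, h⟩
          omega
      · rw [if_neg hmem, if_neg fun h => hmem h.2.1]
  have hn : ((n : Symm) * hsym n).coeff d = n * (hsym n).coeff d := by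
    rw [← map_natCast (C (σ := ℕ+) (R := ℂ)) n, coeff_C_mul]
  rw [hn, coeff_hsym]
  simp only [hterm]
  split_ifs with hd
  · have hz : (zNum d : ℂ) ≠ 0 := by exact_mod_cast zNum_ne_zero d
    have hsum : (n : ℂ) = ∑ k ∈ d.support, (k : ℂ) * d k := by
      rw [← hd, expWeight, Finsupp.weight_apply, Finsupp.sum]
      push_cast [smul_eq_mul]
      exact Finset.sum_congr rfl fun k _ => mul_comm _ _
    rw [hsum, Finset.sum_mul]
    -- Only the terms h_{n-k} p_k with k in the support of d reach p^d. Each contributes k d_k /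
    -- z_d, because z_d = k d_k z_{d - e_k}, and ∑ k d_k = n.
    refine Finset.sum_of_injOn (fun k : ℕ+ => (n - k, (k : ℕ))) ?_ ?_ ?_ ?_
    · intro a _ b _ hab
      exact PNat.coe_injective (congrArg Prod.snd hab)
    · intro k hk
      have := expWeight_sub_single d k hk
      simp only [Finset.mem_coe, Finset.HasAntidiagonal.mem_antidiagonal]
      omega
    · rintro ⟨a, b⟩ hx hx'
      rw [Finset.HasAntidiagonal.mem_antidiagonal] at hx
      rw [if_neg]
      rintro ⟨hb, hmem, -⟩
      apply hx'
      refine ⟨b.toPNat', hmem, ?_⟩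
      simp only [Nat.toPNat'_coe, if_pos hb, Prod.mk.injEq, and_true]
      simp only at hx
      omega
    · intro k hk
      have hw := expWeight_sub_single d k hk
      have hdk : d k ≠ 0 := Finsupp.mem_support_iff.1 hk
      simp only [PNat.coe_toPNat']
      rw [if_pos ⟨k.pos, hk, by omega⟩]
      have h1 := zNum_eq_mul_sub_single k d hdk
      have h2 : (zNum (d - Finsupp.single k 1) : ℂ) ≠ 0 := by exact_mod_cast zNum_ne_zero _
      have h3 : (zNum d : ℂ) = k * d k * zNum (d - Finsupp.single k 1) := by exact_mod_cast h1
      rw [← div_eq_mul_inv, div_eq_iff hz, h3]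
      field_simp
  · rw [mul_zero]
    symm
    refine Finset.sum_eq_zero fun x hx => if_neg fun h => hd ?_
    rw [Finset.HasAntidiagonal.mem_antidiagonal] at hx
    rw [h.2.2, hx]

/-- The involution `ω` with `ω(p_k) = (-1)^{k-1} p_k`. -/
def omegaHom : Symm →ₐ[ℂ] Symm := aeval fun k : ℕ+ => (-1) ^ ((k : ℕ) + 1) * X k

theorem omegaHom_psumN (k : ℕ) : omegaHom (psumN k) = (-1) ^ (k + 1) * psumN k := by
  rcases Nat.eq_zero_or_pos k with rfl | hk
  · simp [psumN_zero]
  · rw [psumN_of_pos hk, omegaHom, aeval_X, Nat.toPNat'_coe, if_pos hk]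

theorem omegaHom_monomial_typeExp (s : Multiset ℕ) (hs : ∀ k ∈ s, 0 < k) :
    omegaHom (monomial (typeExp s) 1) =
      (-1) ^ (s.sum + s.card) * (monomial (typeExp s) 1 : Symm) := by
  induction s using Multiset.induction_on with
  | empty =>
    rw [typeExp_zero, ← C_apply, C_1, map_one]
    simp
  | cons a s ih =>
    have ha := hs a (Multiset.mem_cons_self a s)
    have : (monomial (typeExp (a ::ₘ s)) 1 : Symm) = psumN a * monomial (typeExp s) 1 := by
      rw [typeExp_cons, psumN_of_pos ha, X, monomial_mul, one_mul]
    rw [this, map_mul, ih fun k hk => hs k (Multiset.mem_cons_of_mem hk), omegaHom_psumN,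
      Multiset.sum_cons, Multiset.card_cons]
    ring

/-- The sign of w is (-1) to the power n plus the number of cycles; fixed points add 2 each to this
exponent, so `cycleType` alone determines it. -/
theorem omegaHom_pCycle {n : ℕ} (w : Equiv.Perm (Fin n)) :
    omegaHom (pCycle w) = signChar n w • pCycle w := by
  rw [pCycle, omegaHom_monomial_typeExp _ fun k hk => w.partition.parts_pos hk, smul_eq_C_mul]
  congr 1
  rw [signChar, Equiv.Perm.sign_of_cycleType, Equiv.Perm.parts_partition, Multiset.sum_add,
    Multiset.card_add, Multiset.sum_replicate, Multiset.card_replicate, smul_eq_mul, mul_one]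
  have : ∀ a b c : ℕ, (-1 : Symm) ^ (a + c + (b + c)) = (-1) ^ (a + b) := by
    intro a b c
    rw [show a + c + (b + c) = a + b + 2 * c by ring, pow_add _ (a + b), pow_mul]
    simp
  rw [this]
  simp

theorem omegaHom_ch {n : ℕ} (f : Equiv.Perm (Fin n) → ℂ) :
    omegaHom (ch f) = ch fun w => signChar n w * f w := by
  simp only [ch, map_smul, map_sum, omegaHom_pCycle, smul_smul]
  simp only [mul_comm]

theorem omegaHom_hsym (n : ℕ) : omegaHom (hsym n) = esym n := by
  rw [hsym, omegaHom_ch, esym]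
  simp

theorem esym_zero : esym 0 = 1 := by rw [← omegaHom_hsym, hsym_zero, map_one]

theorem eulerOp_esym : eulerOp Symm (PowerSeries.mk esym) =
    PowerSeries.mk esym * PowerSeries.mk fun k => (-1) ^ (k + 1) * psumN k := by
  have h1 : PowerSeries.mk esym = PowerSeries.map omegaHom.toRingHom (PowerSeries.mk hsym) := by
    ext1 n
    simp [omegaHom_hsym]
  have h2 : (PowerSeries.mk fun k => (-1) ^ (k + 1) * psumN k) =
      PowerSeries.map omegaHom.toRingHom (PowerSeries.mk psumN) := by
    ext1 n
    simp [omegaHom_psumN]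
  rw [h2, h1, eulerOp_map, eulerOp_hsym, map_mul]

/-- The alternating generating series `∑ (-1)^n e_n t^n` of the elementary symmetric functions. -/
def altEsym : PowerSeries Symm := PowerSeries.mk fun n => (-1) ^ n * esym n

/-- This is how `altEsym` acts as the inverse of ∑ h_n t^n: the logarithmic derivatives are
opposite. -/
theorem eulerOp_altEsym : eulerOp Symm altEsym = altEsym * -PowerSeries.mk psumN := by
  ext1 n
  have h := congrArg (PowerSeries.coeff n) eulerOp_esym
  rw [coeff_eulerOp, PowerSeries.coeff_mul, PowerSeries.coeff_mk] at h
  rw [coeff_eulerOp, PowerSeries.coeff_mul, altEsym, PowerSeries.coeff_mk, mul_left_comm, h,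
    Finset.mul_sum]
  refine Finset.sum_congr rfl fun x hx => ?_
  rw [Finset.HasAntidiagonal.mem_antidiagonal] at hx
  simp only [PowerSeries.coeff_mk, map_neg]
  have h2 : ((-1 : Symm) ^ x.2) * (-1) ^ x.2 = 1 := by rw [← mul_pow]; simp
  rw [← hx, pow_add, pow_succ]
  linear_combination (-(-1) ^ x.1 * esym x.1 * psumN x.2) * h2

end Newton

/-! ### Plethysm and Adams operations. -/

section Plethysm

open MvPolynomial

/-- The Adams operation `g ↦ p_k[g]`, with value zero at `k = 0`. -/
def adams (k : ℕ) (g : Symm) : Symm :=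
  if k = 0 then 0 else aeval (fun j : ℕ+ => (X (k.toPNat' * j) : Symm)) g

theorem adams_zero (g : Symm) : adams 0 g = 0 := if_pos rfl

theorem adams_of_pos {k : ℕ} (hk : 0 < k) (g : Symm) :
    adams k g = aeval (fun j : ℕ+ => (X (k.toPNat' * j) : Symm)) g := if_neg hk.ne'

theorem adams_psumN {k : ℕ} (hk : 0 < k) (j : ℕ) : adams k (psumN j) = psumN (k * j) := by
  rw [adams_of_pos hk]
  rcases Nat.eq_zero_or_pos j with rfl | hj
  · simp [psumN_zero]
  · rw [psumN_of_pos hj, psumN_of_pos (Nat.mul_pos hk hj), aeval_X]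
    congr 1
    apply PNat.coe_injective
    simp [hk, hj, Nat.toPNat'_coe]

/-- Plethysm by `g` as a ring homomorphism. -/
def plethysmHom (g : Symm) : Symm →+* Symm :=
  (aeval (fun k : ℕ+ => aeval (fun j : ℕ+ => (X (k * j) : Symm)) g) : Symm →ₐ[ℂ] Symm).toRingHom

theorem plethysmHom_apply (f g : Symm) : plethysmHom g f = plethysm f g := rfl

theorem plethysmHom_psumN (k : ℕ) (g : Symm) : plethysmHom g (psumN k) = adams k g := by
  rcases Nat.eq_zero_or_pos k with rfl | hk
  · rw [psumN_zero, map_zero, adams_zero]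
  · rw [psumN_of_pos hk, adams_of_pos hk, plethysmHom_apply, plethysm, aeval_X]

theorem eulerOp_plethysm_hsym (g : Symm) :
    eulerOp Symm (PowerSeries.mk fun m => plethysm (hsym m) g) =
      (PowerSeries.mk fun m => plethysm (hsym m) g) * PowerSeries.mk fun k => adams k g := by
  have h1 : (PowerSeries.mk fun m => plethysm (hsym m) g) =
      PowerSeries.map (plethysmHom g) (PowerSeries.mk hsym) := by
    ext1 n
    simp [plethysmHom_apply]
  have h2 : (PowerSeries.mk fun k => adams k g) =
      PowerSeries.map (plethysmHom g) (PowerSeries.mk psumN) := by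
    ext1 n
    simp [plethysmHom_psumN]
  rw [h2, h1, eulerOp_map, eulerOp_hsym, map_mul]

theorem eulerOp_plethysm_esym (g : Symm) :
    eulerOp Symm (PowerSeries.mk fun m => plethysm (esym m) g) =
      (PowerSeries.mk fun m => plethysm (esym m) g) *
        PowerSeries.mk fun k => (-1) ^ (k + 1) * adams k g := by
  have h1 : (PowerSeries.mk fun m => plethysm (esym m) g) =
      PowerSeries.map (plethysmHom g) (PowerSeries.mk esym) := by
    ext1 n
    simp [plethysmHom_apply]
  have h2 : (PowerSeries.mk fun k => (-1) ^ (k + 1) * adams k g) =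
      PowerSeries.map (plethysmHom g) (PowerSeries.mk fun k => (-1) ^ (k + 1) * psumN k) := by
    ext1 n
    simp [plethysmHom_psumN]
  rw [h2, h1, eulerOp_map, eulerOp_esym, map_mul]

end Plethysm

/-! ### Sums of primitive roots of unity. -/

section RootSums

open Polynomial

/-- The sum of the primitive `d`-th roots of unity (the value `μ(d)` of the Möbius function). -/
def primitiveRootSum (d : ℕ) : ℂ := ∑ ζ ∈ primitiveRoots d ℂ, ζ

theorem sum_nthRootsFinset_one {N : ℕ} (hN : 0 < N) :
    ∑ ζ ∈ nthRootsFinset N (1 : ℂ), ζ = if N = 1 then 1 else 0 := by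
  split_ifs with h
  · subst h
    have : nthRootsFinset 1 (1 : ℂ) = {1} := by
      ext z
      rw [mem_nthRootsFinset one_pos, pow_one, Finset.mem_singleton]
    rw [this, Finset.sum_singleton]
  · obtain ⟨η, hη⟩ : ∃ η : ℂ, IsPrimitiveRoot η N := ⟨_, Complex.isPrimitiveRoot_exp N hN.ne'⟩
    have h0 : η ≠ 0 := hη.ne_zero hN.ne'
    have h1 : η ≠ 1 := hη.ne_one (by omega)
    -- Multiplication by η permutes the N-th roots of unity; as η ≠ 1, their sum vanishes.
    have hmul : η * ∑ ζ ∈ nthRootsFinset N (1 : ℂ), ζ = ∑ ζ ∈ nthRootsFinset N (1 : ℂ), ζ := by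
      rw [Finset.mul_sum]
      refine Finset.sum_nbij' (fun z => η * z) (fun z => η⁻¹ * z) ?_ ?_ ?_ ?_ ?_
      · intro z hz
        rw [mem_nthRootsFinset hN] at hz ⊢
        rw [mul_pow, hη.pow_eq_one, hz, one_mul]
      · intro z hz
        rw [mem_nthRootsFinset hN] at hz ⊢
        rw [mul_pow, inv_pow, hη.pow_eq_one, hz, inv_one, one_mul]
      · intro z _
        exact inv_mul_cancel_left₀ h0 z
      · intro z _
        exact mul_inv_cancel_left₀ h0 z
      · intro z _
        rfl
    have : (η - 1) * ∑ ζ ∈ nthRootsFinset N (1 : ℂ), ζ = 0 := by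
      rw [sub_mul, hmul, one_mul, sub_self]
    exact (mul_eq_zero.1 this).resolve_left (sub_ne_zero.2 h1)

theorem sum_nthRootsFinset_eq_sum_divisors {M : Type*} [AddCommMonoid M] (N : ℕ) (f : ℂ → M) :
    ∑ ζ ∈ nthRootsFinset N (1 : ℂ), f ζ = ∑ d ∈ N.divisors, ∑ ζ ∈ primitiveRoots d ℂ, f ζ := by
  classical
  rw [IsPrimitiveRoot.nthRoots_one_eq_biUnion_primitiveRoots, Finset.sum_biUnion]
  intro a _ b _ hab
  exact IsPrimitiveRoot.disjoint hab

theorem sum_primitiveRootSum {N : ℕ} (hN : 0 < N) :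
    ∑ d ∈ N.divisors, primitiveRootSum d = if N = 1 then 1 else 0 := by
  rw [← sum_nthRootsFinset_one hN, sum_nthRootsFinset_eq_sum_divisors]
  rfl

/-- Write (-1)^m as 2[2 ∣ m] - 1. The divisors d of N with N/d even are the divisors of N/2, so the
untwisted sum applies to N and, when N is even, to N/2. -/
theorem sum_primitiveRootSum_mul_neg_one_pow {N : ℕ} (hN : 0 < N) :
    ∑ d ∈ N.divisors, primitiveRootSum d * (-1) ^ (N / d) =
      if N = 1 then -1 else if N = 2 then 2 else 0 := by
  have hterm : ∀ d ∈ N.divisors, primitiveRootSum d * (-1) ^ (N / d) =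
      2 * (if 2 ∣ N / d then primitiveRootSum d else 0) - primitiveRootSum d := by
    intro d _
    split_ifs with h
    · rw [(even_iff_two_dvd.2 h).neg_one_pow]
      ring
    · rw [(Nat.not_even_iff_odd.1 fun h' => h (even_iff_two_dvd.1 h')).neg_one_pow]
      ring
  rw [Finset.sum_congr rfl hterm, Finset.sum_sub_distrib, ← Finset.mul_sum,
    sum_primitiveRootSum hN, ← Finset.sum_filter]
  by_cases h2 : 2 ∣ N
  · obtain ⟨m, rfl⟩ := h2
    have hm : 0 < m := by omega
    have : (2 * m).divisors.filter (fun d => 2 ∣ 2 * m / d) = m.divisors := by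
      ext d
      simp only [Finset.mem_filter, Nat.mem_divisors]
      constructor
      · rintro ⟨⟨⟨k, hk⟩, -⟩, h⟩
        have hd : 0 < d := Nat.pos_of_ne_zero (by rintro rfl; omega)
        rw [hk, Nat.mul_div_cancel_left _ hd] at h
        obtain ⟨l, rfl⟩ := h
        exact ⟨⟨l, by nlinarith⟩, hm.ne'⟩
      · rintro ⟨⟨l, rfl⟩, -⟩
        have hd : 0 < d := Nat.pos_of_ne_zero (by rintro rfl; omega)
        refine ⟨⟨⟨2 * l, by ring⟩, by omega⟩, l, ?_⟩
        rw [show 2 * (d * l) = d * (2 * l) by ring, Nat.mul_div_cancel_left _ hd]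
    rw [this, sum_primitiveRootSum hm]
    by_cases hm1 : m = 1
    · simp [hm1]
    · simp [hm1, show ¬ 2 * m = 1 by omega]
  · have : N.divisors.filter (fun d => 2 ∣ N / d) = ∅ := by
      refine Finset.filter_eq_empty_iff.2 fun d hd h => h2 ?_
      exact h.trans (Nat.div_dvd_of_dvd (Nat.dvd_of_mem_divisors hd))
    rw [this, Finset.sum_empty]
    by_cases h1 : N = 1
    · simp [h1]
    · simp [h1, show N ≠ 2 by rintro rfl; exact h2 dvd_rfl]

end RootSums

/-! ### The characteristic of Lie_(n) in power sums. -/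

section LieCharacteristic

open MvPolynomial

theorem psumN_pow (k m : ℕ) (hk : 0 < k) :
    psumN k ^ m = monomial (typeExp (Multiset.replicate m k)) 1 := by
  rw [psumN_of_pos hk, typeExp_replicate, X_pow_eq_monomial]

/-- All cycles of a power of an `n`-cycle have the same length. -/
theorem pCycle_of_mem_zpowers {n : ℕ} {c : Equiv.Perm (Fin n)}
    (hc : c.IsCycleOn Set.univ) {h : Equiv.Perm (Fin n)} (hh : h ∈ Subgroup.zpowers c) :
    pCycle h = psumN (orderOf h) ^ (n / orderOf h) := by
  -- A transitive abelian permutation group acts freely. Hence the power of h by the length of one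
  -- of its cycles, fixing a point, is trivial.
  have hfree : ∀ g ∈ Subgroup.zpowers c, ∀ x, g x = x → g = 1 := by
    intro g hg x hx
    ext1 y
    obtain ⟨i, hi⟩ := hc.2 (Set.mem_univ x) (Set.mem_univ y)
    obtain ⟨j, rfl⟩ := hg
    rw [← hi, Equiv.Perm.one_apply, ← Equiv.Perm.mul_apply, ← zpow_add, add_comm, zpow_add,
      Equiv.Perm.mul_apply]
    exact congrArg _ hx
  have hparts : ∀ k ∈ h.partition.parts, k = orderOf h := by
    intro k hk
    rw [Equiv.Perm.parts_partition, Multiset.mem_add] at hk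
    rcases hk with hk | hk
    · refine Nat.dvd_antisymm (Equiv.Perm.dvd_of_mem_cycleType hk) ?_
      rw [Equiv.Perm.cycleType_def, Multiset.mem_map] at hk
      obtain ⟨τ, hτ, rfl⟩ := hk
      rw [Finset.mem_val] at hτ
      have hτ' := Equiv.Perm.mem_cycleFactorsFinset_iff.1 hτ
      obtain ⟨x, hx⟩ : τ.support.Nonempty := hτ'.1.nonempty_support
      apply orderOf_dvd_of_pow_eq_one
      refine hfree _ (Subgroup.pow_mem _ hh _) x ?_
      have hcyc : τ = h.cycleOf x := Equiv.Perm.cycle_is_cycleOf hx hτ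
      simp only [Function.comp_apply]
      rw [← Equiv.Perm.cycleOf_pow_apply_self, ← hcyc, ← hτ'.1.orderOf, pow_orderOf_eq_one,
        Equiv.Perm.one_apply]
    · rw [Multiset.mem_replicate] at hk
      obtain ⟨hk0, rfl⟩ := hk
      have : ∃ x, h x = x := by
        by_contra! hne
        apply hk0
        rw [show h.support = Finset.univ from Finset.eq_univ_iff_forall.2 fun x =>
          Equiv.Perm.mem_support.2 (hne x), Finset.card_univ, Nat.sub_self]
      obtain ⟨x, hx⟩ := this
      rw [hfree h hh x hx, orderOf_one]
  have hrep := Multiset.eq_replicate_card.2 hparts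
  have hsum : h.partition.parts.card * orderOf h = n := by
    have := h.partition.parts_sum
    rw [hrep, Multiset.sum_replicate, smul_eq_mul] at this
    exact this.trans (Fintype.card_fin n)
  have hpos : 0 < orderOf h := orderOf_pos h
  have hcard : h.partition.parts.card = n / orderOf h := by
    exact Nat.eq_div_of_mul_eq_left hpos.ne' hsum
  rw [psumN_pow _ _ hpos, ← hcard, ← hrep]
  rfl

theorem orderOf_eq_of_isCycleOn_univ {n : ℕ} (c : Equiv.Perm (Fin n))
    (hc : c.IsCycleOn Set.univ) (θ : Subgroup.zpowers c →* ℂˣ)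
    (hθ : IsPrimitiveRoot (θ ⟨c, Subgroup.mem_zpowers c⟩) n) : orderOf c = n := by
  refine Nat.dvd_antisymm (orderOf_dvd_of_pow_eq_one ?_) ?_
  · ext1 x
    have := Equiv.Perm.IsCycleOn.pow_card_apply (s := Finset.univ) (f := c) (a := x)
      (by simpa using hc) (Finset.mem_univ x)
    simpa using this
  · refine hθ.dvd_of_pow_eq_one _ ?_
    have : (⟨c, Subgroup.mem_zpowers c⟩ : Subgroup.zpowers c) ^ orderOf c = 1 :=
      Subtype.ext (pow_orderOf_eq_one c)
    rw [← map_pow, this, map_one]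

/-- An element of order d in C_n contributes p_d^{n/d}, and θ matches the elements of order d with
the primitive d-th roots of unity. -/
theorem ch_lieCyclic {n : ℕ} (hn : 0 < n) (c : Equiv.Perm (Fin n))
    (hc : c.IsCycleOn Set.univ) (θ : Subgroup.zpowers c →* ℂˣ)
    (hθ : IsPrimitiveRoot (θ ⟨c, Subgroup.mem_zpowers c⟩) n) :
    (n : Symm) * ch (lieCyclic c θ) =
      ∑ d ∈ n.divisors, C (primitiveRootSum d) * psumN d ^ (n / d) := by
  classical
  let _ : Fintype (Subgroup.zpowers c) := Fintype.ofFinite _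
  have hord := orderOf_eq_of_isCycleOn_univ c hc θ hθ
  have hcard : Fintype.card (Subgroup.zpowers c) = n := by 
    rw [← Nat.card_eq_fintype_card, Nat.card_zpowers, hord]
  have hch : ch (lieCyclic c θ) = (Fintype.card (Subgroup.zpowers c) : ℂ)⁻¹ •
      ∑ h : Subgroup.zpowers c, (θ h : ℂ) • pCycle (h : Equiv.Perm (Fin n)) :=
    ch_induce (Subgroup.zpowers c).subtype fun h => (θ h : ℂ)
  have hn' : (n : ℂ) ≠ 0 := by exact_mod_cast hn.ne'
  have hinj : Function.Injective θ := by
    rw [injective_iff_map_eq_one]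
    rintro ⟨h, hh⟩ h1
    obtain ⟨i, rfl⟩ := hh
    have hz : (⟨c ^ i, ⟨i, rfl⟩⟩ : Subgroup.zpowers c) = ⟨c, Subgroup.mem_zpowers c⟩ ^ i := rfl
    rw [hz, map_zpow, hθ.zpow_eq_one_iff_dvd] at h1
    apply Subtype.ext
    change c ^ i = 1
    rwa [← orderOf_dvd_iff_zpow_eq_one, hord]
  have hinj' : Function.Injective fun h : Subgroup.zpowers c => (θ h : ℂ) :=
    Units.val_injective.comp hinj
  have hmaps : ∀ h : Subgroup.zpowers c, (θ h : ℂ) ∈ Polynomial.nthRootsFinset n (1 : ℂ) := by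
    intro h
    have h1 : h ^ n = 1 := by
      have := pow_card_eq_one (x := h)
      rwa [hcard] at this
    rw [Polynomial.mem_nthRootsFinset hn, ← Units.val_pow_eq_pow_val, ← map_pow, h1, map_one,
      Units.val_one]
  have hsum : ∑ h : Subgroup.zpowers c, (θ h : ℂ) • pCycle (h : Equiv.Perm (Fin n)) =
      ∑ ζ ∈ Polynomial.nthRootsFinset n (1 : ℂ), ζ • psumN (orderOf ζ) ^ (n / orderOf ζ) := by
    refine Finset.sum_nbij (fun h => (θ h : ℂ)) (fun h _ => hmaps h) hinj'.injOn ?_ ?_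
    · refine Finset.surjOn_of_injOn_of_card_le _ (fun h _ => hmaps h) hinj'.injOn ?_
      rw [(IsPrimitiveRoot.coe_units_iff.2 hθ).card_nthRootsFinset, Finset.card_univ, hcard]
    · intro h _
      have : orderOf (θ h : ℂ) = orderOf (h : Equiv.Perm (Fin n)) := by
        rw [orderOf_units, orderOf_injective θ hinj, Subgroup.orderOf_coe]
      rw [this, pCycle_of_mem_zpowers hc h.2]
  rw [hch, hcard, hsum, sum_nthRootsFinset_eq_sum_divisors, ← map_natCast (C (σ := ℕ+) (R := ℂ)) n,
    ← smul_eq_C_mul, smul_inv_smul₀ hn']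
  refine Finset.sum_congr rfl fun d hd => ?_
  rw [← smul_eq_C_mul, primitiveRootSum, Finset.sum_smul]
  refine Finset.sum_congr rfl fun ζ hζ => ?_
  rw [← (isPrimitiveRoot_of_mem_primitiveRoots hζ).eq_orderOf]

end LieCharacteristic

/-! ### Möbius cancellation for the Lie and Whitney products. -/

section PowerSumIdentities

open MvPolynomial

/-- The new index N = (i/j) d is the subscript produced by p_{i/j}[p_d]. For fixed d the map j ↦ N
is its own inverse. After the change the power sum depends on N alone, leaving a Möbius sum over d.
-/
theorem sum_divisors_divisors_swap {M : Type*} [AddCommMonoid M] {i : ℕ} (hi : 0 < i)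
    (F : ℕ → ℕ → M) :
    ∑ j ∈ i.divisors, ∑ d ∈ j.divisors, F j d =
      ∑ N ∈ i.divisors, ∑ d ∈ N.divisors, F (i / N * d) d := by
  have hkey : ∀ a d : ℕ, a ∈ i.divisors → d ∈ a.divisors →
      i / a * d ∈ i.divisors ∧ d ∈ (i / a * d).divisors ∧ i / (i / a * d) * d = a := by
    intro a d ha hd
    obtain ⟨b, rfl⟩ := Nat.dvd_of_mem_divisors ha
    have ha0 := Nat.pos_of_mem_divisors ha
    obtain ⟨e, rfl⟩ := Nat.dvd_of_mem_divisors hd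
    have hd0 := Nat.pos_of_mem_divisors hd
    have he0 : 0 < e := Nat.pos_of_mul_pos_left ha0
    have hb0 : 0 < b := Nat.pos_of_mul_pos_left hi
    rw [Nat.mul_div_cancel_left _ ha0]
    refine ⟨Nat.mem_divisors.2 ⟨⟨e, by ring⟩, hi.ne'⟩,
      Nat.mem_divisors.2 ⟨Dvd.intro_left b rfl, (Nat.mul_pos hb0 hd0).ne'⟩, ?_⟩
    rw [show d * e * b = b * d * e by ring, Nat.mul_div_cancel_left _ (Nat.mul_pos hb0 hd0),
      mul_comm]
  rw [Finset.sum_sigma', Finset.sum_sigma']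
  refine Finset.sum_nbij' (fun x => ⟨i / x.1 * x.2, x.2⟩) (fun x => ⟨i / x.1 * x.2, x.2⟩)
    ?_ ?_ ?_ ?_ ?_
  · rintro ⟨a, d⟩ hx
    rw [Finset.mem_sigma] at hx ⊢
    exact ⟨(hkey a d hx.1 hx.2).1, (hkey a d hx.1 hx.2).2.1⟩
  · rintro ⟨a, d⟩ hx
    rw [Finset.mem_sigma] at hx ⊢
    exact ⟨(hkey a d hx.1 hx.2).1, (hkey a d hx.1 hx.2).2.1⟩
  · rintro ⟨a, d⟩ hx
    rw [Finset.mem_sigma] at hx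
    simp only [(hkey a d hx.1 hx.2).2.2]
  · rintro ⟨a, d⟩ hx
    rw [Finset.mem_sigma] at hx
    simp only [(hkey a d hx.1 hx.2).2.2]
  · rintro ⟨a, d⟩ hx
    rw [Finset.mem_sigma] at hx
    simp only [(hkey a d hx.1 hx.2).2.2]

theorem natCast_mul_adams {k : ℕ} (hk : 0 < k) (j : ℕ) (F : Symm) (s : Finset ℕ) (a : ℕ → ℂ)
    (m : ℕ → ℕ) (h : (j : Symm) * F = ∑ d ∈ s, C (a d) * psumN d ^ m d) :
    (j : Symm) * adams k F = ∑ d ∈ s, C (a d) * psumN (k * d) ^ m d := by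
  have h1 := congrArg (aeval (fun j : ℕ+ => (X (k.toPNat' * j) : Symm))) h
  rw [map_mul, map_natCast, map_sum, ← adams_of_pos hk] at h1
  rw [h1]
  refine Finset.sum_congr rfl fun d _ => ?_
  rw [map_mul, map_pow, ← adams_of_pos hk (psumN d), adams_psumN hk, algHom_C]
  rfl

variable {c : ∀ n : ℕ, Equiv.Perm (Fin n)} {θ : ∀ n : ℕ, Subgroup.zpowers (c n) →* ℂˣ}

theorem natCast_mul_ell (hc : ∀ n : ℕ, (c n).IsCycleOn Set.univ)
    (hθ : ∀ n : ℕ, 1 ≤ n → IsPrimitiveRoot (θ n ⟨c n, Subgroup.mem_zpowers (c n)⟩) n)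
    {j : ℕ} (hj : 0 < j) :
    (j : Symm) * ell c θ j = ∑ d ∈ j.divisors, C (primitiveRootSum d) * psumN d ^ (j / d) :=
  ch_lieCyclic hj (c j) (hc j) (θ j) (hθ j hj)

theorem natCast_mul_pie (hc : ∀ n : ℕ, (c n).IsCycleOn Set.univ)
    (hθ : ∀ n : ℕ, 1 ≤ n → IsPrimitiveRoot (θ n ⟨c n, Subgroup.mem_zpowers (c n)⟩) n)
    {j : ℕ} (hj : 0 < j) :
    (j : Symm) * pie c θ j = ∑ d ∈ j.divisors,
      C (primitiveRootSum d * ((-1) ^ (d + 1)) ^ (j / d)) * psumN d ^ (j / d) := by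
  have h := congrArg omegaHom (natCast_mul_ell hc hθ hj)
  rw [map_mul, map_natCast, map_sum, ell, omegaHom_ch] at h
  refine h.trans (Finset.sum_congr rfl fun d _ => ?_)
  rw [map_mul, map_pow, omegaHom_psumN, algHom_C, mul_pow, C_mul, mul_assoc]
  simp

theorem ell_one (hc : ∀ n : ℕ, (c n).IsCycleOn Set.univ)
    (hθ : ∀ n : ℕ, 1 ≤ n → IsPrimitiveRoot (θ n ⟨c n, Subgroup.mem_zpowers (c n)⟩) n) :
    ell c θ 1 = psumN 1 := by
  have h := natCast_mul_ell hc hθ one_pos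
  simpa [primitiveRootSum] using h

theorem pie_one (hc : ∀ n : ℕ, (c n).IsCycleOn Set.univ)
    (hθ : ∀ n : ℕ, 1 ≤ n → IsPrimitiveRoot (θ n ⟨c n, Subgroup.mem_zpowers (c n)⟩) n) :
    pie c θ 1 = psumN 1 := by
  have h := natCast_mul_pie hc hθ one_pos
  simpa [primitiveRootSum] using h

/-- The logarithmic form of `∏_j H[ℓ_j] = (1 - p_1)⁻¹`. -/
theorem sum_adams_ell (hc : ∀ n : ℕ, (c n).IsCycleOn Set.univ)
    (hθ : ∀ n : ℕ, 1 ≤ n → IsPrimitiveRoot (θ n ⟨c n, Subgroup.mem_zpowers (c n)⟩) n)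
    {i : ℕ} (hi : 0 < i) :
    ∑ j ∈ i.divisors, (j : Symm) * adams (i / j) (ell c θ j) = psumN 1 ^ i := by
  have h1 : ∀ j ∈ i.divisors, (j : Symm) * adams (i / j) (ell c θ j) =
      ∑ d ∈ j.divisors, C (primitiveRootSum d) * psumN (i / j * d) ^ (j / d) := fun j hj =>
    natCast_mul_adams (Nat.div_pos (Nat.divisor_le hj) (Nat.pos_of_mem_divisors hj)) _ _ _ _ _
      (natCast_mul_ell hc hθ (Nat.pos_of_mem_divisors hj))
  rw [Finset.sum_congr rfl h1, sum_divisors_divisors_swap hi]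
  have h2 : ∀ N ∈ i.divisors, ∑ d ∈ N.divisors,
      C (primitiveRootSum d) * psumN (i / (i / N * d) * d) ^ (i / N * d / d) =
        if N = 1 then psumN 1 ^ i else 0 := by
    intro N hN
    have hN0 := Nat.pos_of_mem_divisors hN
    have h3 : ∀ d ∈ N.divisors,
        C (primitiveRootSum d) * psumN (i / (i / N * d) * d) ^ (i / N * d / d) =
          C (primitiveRootSum d) * psumN N ^ (i / N) := by
      intro d hd
      have hd0 := Nat.pos_of_mem_divisors hd
      rw [Nat.mul_div_cancel _ hd0, ← Nat.div_div_eq_div_mul,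
        Nat.div_div_self (Nat.dvd_of_mem_divisors hN) hi.ne',
        Nat.div_mul_cancel (Nat.dvd_of_mem_divisors hd)]
    rw [Finset.sum_congr rfl h3, ← Finset.sum_mul, ← map_sum, sum_primitiveRootSum hN0]
    split_ifs with h
    · rw [h, Nat.div_one, C_1, one_mul]
    · rw [C_0, zero_mul]
  rw [Finset.sum_congr rfl h2, Finset.sum_ite_eq', if_pos (Nat.one_mem_divisors.2 hi.ne')]

/-- The logarithmic form of `∏_{j odd} H[π_j] ∏_{j even} E[π_j] = (1 + p_2) / (1 - p_1)`. -/
theorem sum_adams_pie (hc : ∀ n : ℕ, (c n).IsCycleOn Set.univ)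
    (hθ : ∀ n : ℕ, 1 ≤ n → IsPrimitiveRoot (θ n ⟨c n, Subgroup.mem_zpowers (c n)⟩) n)
    {i : ℕ} (hi : 0 < i) :
    ∑ j ∈ i.divisors, (j : Symm) *
        (if Odd j then adams (i / j) (pie c θ j)
          else (-1) ^ (i / j + 1) * adams (i / j) (pie c θ j)) =
      psumN 1 ^ i + if 2 ∣ i then 2 * (-1) ^ (i / 2 + 1) * psumN 2 ^ (i / 2) else 0 := by
  have h1 : ∀ j ∈ i.divisors, (j : Symm) *
        (if Odd j then adams (i / j) (pie c θ j)
          else (-1) ^ (i / j + 1) * adams (i / j) (pie c θ j)) =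
      ∑ d ∈ j.divisors, (C (primitiveRootSum d) *
        (-1) ^ ((i / j + 1) * (j + 1) + (d + 1) * (j / d))) * psumN (i / j * d) ^ (j / d) := by
    intro j hj
    have hj0 := Nat.pos_of_mem_divisors hj
    have h := natCast_mul_adams (Nat.div_pos (Nat.divisor_le hj) hj0) _ _ _ _ _
      (natCast_mul_pie hc hθ hj0)
    -- The exponent (i/j + 1)(j + 1) merges the cases: it is even for odd j and has the parity of
    -- i/j + 1 for even j.
    have h' : (if Odd j then adams (i / j) (pie c θ j)
        else (-1) ^ (i / j + 1) * adams (i / j) (pie c θ j)) =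
          (-1) ^ ((i / j + 1) * (j + 1)) * adams (i / j) (pie c θ j) := by
      rw [mul_comm (i / j + 1), pow_mul]
      split_ifs with ho
      · rw [ho.add_one.neg_one_pow, one_pow, one_mul]
      · rw [(Nat.not_odd_iff_even.1 ho).add_one.neg_one_pow]
    rw [h', mul_left_comm, h, Finset.mul_sum]
    refine Finset.sum_congr rfl fun d _ => ?_
    rw [C_mul, pow_add _ ((i / j + 1) * (j + 1)), pow_mul _ (d + 1)]
    simp only [map_pow, map_neg, C_1]
    ring
  rw [Finset.sum_congr rfl h1, sum_divisors_divisors_swap hi]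
  have h2 : ∀ N ∈ i.divisors, ∑ d ∈ N.divisors, (C (primitiveRootSum d) *
        (-1) ^ ((i / (i / N * d) + 1) * (i / N * d + 1) + (d + 1) * (i / N * d / d))) *
          psumN (i / (i / N * d) * d) ^ (i / N * d / d) =
        (if N = 1 then psumN 1 ^ i else 0) +
          if N = 2 then 2 * (-1) ^ (i / 2 + 1) * psumN 2 ^ (i / 2) else 0 := by
    intro N hN
    have hN0 := Nat.pos_of_mem_divisors hN
    have h3 : ∀ d ∈ N.divisors, (C (primitiveRootSum d) *
        (-1) ^ ((i / (i / N * d) + 1) * (i / N * d + 1) + (d + 1) * (i / N * d / d))) *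
          psumN (i / (i / N * d) * d) ^ (i / N * d / d) =
          C (primitiveRootSum d * (-1) ^ (N / d)) *
            ((-1) ^ ((N + 1) * (i / N) + 1) * psumN N ^ (i / N)) := by
      intro d hd
      have hd0 := Nat.pos_of_mem_divisors hd
      rw [Nat.mul_div_cancel _ hd0, ← Nat.div_div_eq_div_mul,
        Nat.div_div_self (Nat.dvd_of_mem_divisors hN) hi.ne',
        Nat.div_mul_cancel (Nat.dvd_of_mem_divisors hd), C_mul]
      obtain ⟨k, hk⟩ := Nat.dvd_of_mem_divisors hd
      have hkd : N / d = k := by rw [hk, Nat.mul_div_cancel_left _ hd0]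
      rw [hkd]
      generalize i / N = m
      -- Modulo 2 the sign exponent splits into N/d, which twists the Möbius sum, and a part
      -- depending only on N and i/N.
      have : ((-1) ^ ((k + 1) * (m * d + 1) + (d + 1) * m) : Symm) =
          (-1) ^ k * (-1) ^ ((N + 1) * m + 1) := by
        rw [← pow_add, hk, show (k + 1) * (m * d + 1) + (d + 1) * m =
          k + ((d * k + 1) * m + 1) + 2 * (m * d) by ring, pow_add _ _ (2 * (m * d)), pow_mul _ 2]
        simp
      rw [this]
      simp only [map_pow, map_neg, C_1]
      ring
    rw [Finset.sum_congr rfl h3, ← Finset.sum_mul, ← map_sum,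
      sum_primitiveRootSum_mul_neg_one_pow hN0]
    by_cases hN1 : N = 1
    · subst hN1
      rw [if_pos rfl, if_pos rfl, if_neg (by norm_num), Nat.div_one, add_zero, pow_succ,
        pow_mul]
      simp
    · rw [if_neg hN1, if_neg hN1, zero_add]
      by_cases hN2 : N = 2
      · subst hN2
        rw [if_pos rfl, if_pos rfl, show (2 + 1) * (i / 2) + 1 = (i / 2 + 1) + 2 * (i / 2) by ring,
          pow_add _ (i / 2 + 1), pow_mul _ 2]
        simp only [map_ofNat]
        ring
      · rw [if_neg hN2, if_neg hN2, C_0, zero_mul]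
  rw [Finset.sum_congr rfl h2, Finset.sum_add_distrib, Finset.sum_ite_eq', Finset.sum_ite_eq',
    if_pos (Nat.one_mem_divisors.2 hi.ne')]
  congr 1
  refine if_congr ?_ rfl rfl
  rw [Nat.mem_divisors]
  exact ⟨fun h => h.1, fun h => ⟨h, hi.ne'⟩⟩

end PowerSumIdentities

/-! ### Generating series over partitions without parts 1. -/

section Derangements

open MvPolynomial

/-- The factor for `j = 1` is dropped, which restricts partitions to those without parts `1`. -/
def dropOnes (B : ℕ → ℕ → Symm) (j : ℕ) : PowerSeries Symm :=
  if j = 1 then 1 else PowerSeries.mk (B j)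

theorem coeff_partitionSeries_dropOnes (B : ℕ → ℕ → Symm) (hB : B 1 0 = 1) (n : ℕ) :
    PowerSeries.coeff n (partitionSeries (dropOnes B)) =
      ∑ lam ∈ Finset.univ.filter (fun lam : n.Partition => 1 ∉ lam.parts),
        ∏ j ∈ Finset.Icc 1 n, B j (lam.parts.count j) := by
  rw [partitionSeries, PowerSeries.coeff_mk, Finset.sum_filter]
  refine Finset.sum_congr rfl fun lam _ => ?_
  by_cases h : 1 ∉ lam.parts
  · rw [if_pos h]
    refine Finset.prod_congr rfl fun j _ => ?_
    rw [dropOnes]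
    split_ifs with hj
    · rw [hj, Multiset.count_eq_zero_of_notMem h, hB, PowerSeries.coeff_zero_one]
    · rw [PowerSeries.coeff_mk]
  · rw [if_neg h]
    rw [not_not] at h
    refine Finset.prod_eq_zero (Finset.mem_Icc.2 ⟨le_rfl, lam.le_of_mem_parts h⟩) ?_
    rw [dropOnes, if_pos rfl, PowerSeries.coeff_one, if_neg (Multiset.count_pos.2 h).ne']

theorem rank_le {n : ℕ} (lam : n.Partition) : rank lam ≤ n := by
  have h := Multiset.sum_map_le_sum_map (s := lam.parts) (fun k => k - 1) id
    fun k _ => Nat.sub_le k 1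
  rwa [Multiset.map_id, lam.parts_sum] at h

/-- Ranks are at most n, so summing over rank recovers all partitions without parts 1. The products
on the left keep their factor at j = 1, which is harmless because B 1 0 = 1. -/
theorem sum_derangementPartitions (B : ℕ → ℕ → Symm) (hB : B 1 0 = 1) (n : ℕ) :
    ∑ i ∈ Finset.range (n + 1), ∑ lam ∈ derangementPartitions n i,
        chInv n (∏ j ∈ Finset.Icc 1 n, B j (lam.parts.count j)) =
      chInv n (PowerSeries.coeff n (partitionSeries (dropOnes B))) := by
  rw [coeff_partitionSeries_dropOnes B hB, chInv_sum,
    ← Finset.sum_fiberwise_of_maps_to (g := rank) (t := Finset.range (n + 1))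
      fun lam _ => Finset.mem_range.2 (Nat.lt_succ_of_le (rank_le lam))]
  refine Finset.sum_congr rfl fun i _ => ?_
  rw [Finset.filter_filter]
  rfl

theorem coeff_zero_partitionSeries (A : ℕ → PowerSeries Symm) :
    PowerSeries.coeff 0 (partitionSeries A) = 1 := by
  simp [partitionSeries]

/-- The series `∑_{n ≥ 1} p_1^n t^n`. -/
def geomSeries : PowerSeries Symm := PowerSeries.mk fun n => if n = 0 then 0 else psumN 1 ^ n

theorem geomSeries_eq : geomSeries =
    PowerSeries.C (psumN 1) * PowerSeries.X + PowerSeries.C (psumN 1) * PowerSeries.X * geomSeries := by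
  ext1 n
  rw [mul_assoc, ← mul_add, PowerSeries.coeff_C_mul]
  rcases n with _ | n
  · simp [geomSeries]
  · rw [map_add, PowerSeries.coeff_succ_X_mul, geomSeries, PowerSeries.coeff_mk,
      PowerSeries.coeff_mk, PowerSeries.coeff_X]
    rcases n with _ | n
    · simp
    · simp [pow_succ']

theorem eulerOp_C_mul_X_pow (a : Symm) (m : ℕ) :
    eulerOp Symm (PowerSeries.C a * PowerSeries.X ^ m) =
      (m : PowerSeries Symm) * (PowerSeries.C a * PowerSeries.X ^ m) := by
  have h : eulerOp Symm (PowerSeries.C a) = 0 := by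
    ext1 n
    rw [coeff_eulerOp, PowerSeries.coeff_C]
    split_ifs with hn
    · simp [hn]
    · simp
  rw [Derivation.leibniz, h, eulerOp_X_pow]
  simp only [smul_eq_mul, mul_zero, add_zero]
  ring

/-- A series with logarithmic derivative `p_1 t / (1 - p_1 t) + U - ∑ p_k t^k`. -/
theorem one_sub_mul_eq_of_eulerOp {S U V : PowerSeries Symm}
    (hS : eulerOp Symm S = S * (geomSeries + U - PowerSeries.mk psumN))
    (hV : eulerOp Symm V = V * U) (hS0 : PowerSeries.coeff 0 S = 1)
    (hV0 : PowerSeries.coeff 0 V = 1) (hU0 : PowerSeries.coeff 0 U = 0) :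
    (1 - PowerSeries.C (psumN 1) * PowerSeries.X) * S = V * altEsym := by
  refine eq_of_eulerOp_eq_mul (G := U - PowerSeries.mk psumN) ?_ ?_ ?_ ?_
  · rw [map_sub, hU0, PowerSeries.coeff_mk, psumN_zero, sub_zero]
  · have h1 := eulerOp_C_mul_X_pow (psumN 1) 1
    rw [pow_one, Nat.cast_one, one_mul] at h1
    have h2 := geomSeries_eq
    rw [Derivation.leibniz, hS, map_sub, Derivation.map_one_eq_zero, h1]
    simp only [smul_eq_mul]
    -- The derivative of 1 - p_1 t contributes -p_1 t, which cancels (1 - p_1 t) times the geometric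
    -- term.
    linear_combination S * h2
  · rw [Derivation.leibniz, eulerOp_altEsym, hV]
    simp only [smul_eq_mul]
    ring
  · simp only [PowerSeries.coeff_zero_eq_constantCoeff_apply] at hS0 hV0 ⊢
    simp [hS0, hV0, altEsym, esym_zero]

variable {c : ∀ n : ℕ, Equiv.Perm (Fin n)} {θ : ∀ n : ℕ, Subgroup.zpowers (c n) →* ℂˣ}

theorem sum_divisors_dropOnes (g : ℕ → ℕ → Symm) {n : ℕ} (hn : 0 < n) :
    ∑ j ∈ n.divisors, (j : Symm) * PowerSeries.coeff (n / j)
        (if j = 1 then 0 else PowerSeries.mk (g j) : PowerSeries Symm) =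
      ∑ j ∈ n.divisors, (j : Symm) * g j (n / j) - g 1 n := by
  have h1 := Nat.one_mem_divisors.2 hn.ne'
  rw [← Finset.add_sum_erase _ _ h1, ← Finset.add_sum_erase _ (fun j : ℕ => (j : Symm) * g j (n / j)) h1]
  simp only [if_true, map_zero, mul_zero, zero_add, Nat.cast_one, one_mul, Nat.div_one,
    add_sub_cancel_left]
  refine Finset.sum_congr rfl fun j hj => ?_
  rw [if_neg (Finset.ne_of_mem_erase hj), PowerSeries.coeff_mk]

/-- By `hU` the full product would have logarithmic derivative p_1 t/(1 - p_1 t) + U; dropping j = 1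
subtracts ∑ p_k t^k, by `hg1`. -/
theorem eulerOp_partitionSeries_dropOnes (B g : ℕ → ℕ → Symm) (hB : ∀ j, B j 0 = 1)
    (hg : ∀ j, g j 0 = 0) (hBg : ∀ j, eulerOp Symm (PowerSeries.mk (B j)) =
      PowerSeries.mk (B j) * PowerSeries.mk (g j)) (hg1 : ∀ n, 0 < n → g 1 n = psumN n)
    (U : PowerSeries Symm) (hU0 : PowerSeries.coeff 0 U = 0)
    (hU : ∀ n : ℕ, 0 < n → ∑ j ∈ n.divisors, (j : Symm) * g j (n / j) =
      psumN 1 ^ n + PowerSeries.coeff n U) :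
    eulerOp Symm (partitionSeries (dropOnes B)) =
      partitionSeries (dropOnes B) * (geomSeries + U - PowerSeries.mk psumN) := by
  rw [eulerOp_partitionSeries (dropOnes B) (fun j => if j = 1 then 0 else PowerSeries.mk (g j))]
  · congr 1
    ext1 n
    rw [PowerSeries.coeff_mk, map_sub, map_add, geomSeries, PowerSeries.coeff_mk,
      PowerSeries.coeff_mk]
    rcases Nat.eq_zero_or_pos n with rfl | hn
    · simp [hU0, psumN_zero]
    · rw [sum_divisors_dropOnes g hn, hU n hn, hg1 n hn, if_neg hn.ne']
  · intro j
    rw [dropOnes]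
    split_ifs
    · simp
    · rw [PowerSeries.coeff_mk, hB]
  · intro j
    split_ifs
    · simp
    · rw [PowerSeries.coeff_mk, hg]
  · intro j
    rw [dropOnes]
    split_ifs
    · simp
    · exact hBg j

theorem plethysm_one (g : Symm) : plethysm 1 g = 1 := by
  rw [← plethysmHom_apply, map_one]

/-- The generating series of the characteristics of `Lie-hat`. -/
def lieSeries (c : ∀ n : ℕ, Equiv.Perm (Fin n)) (θ : ∀ n : ℕ, Subgroup.zpowers (c n) →* ℂˣ) :
    PowerSeries Symm :=
  partitionSeries (dropOnes fun j m => plethysm (hsym m) (ell c θ j))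

theorem lieHat_eq (n : ℕ) : lieHat c θ n = chInv n (PowerSeries.coeff n (lieSeries c θ)) := by
  rw [lieSeries, ← sum_derangementPartitions _ (by rw [hsym_zero, plethysm_one])]
  rfl

theorem one_sub_mul_lieSeries (hc : ∀ n : ℕ, (c n).IsCycleOn Set.univ)
    (hθ : ∀ n : ℕ, 1 ≤ n → IsPrimitiveRoot (θ n ⟨c n, Subgroup.mem_zpowers (c n)⟩) n) :
    (1 - PowerSeries.C (psumN 1) * PowerSeries.X) * lieSeries c θ = altEsym := by
  rw [← one_mul altEsym]
  refine one_sub_mul_eq_of_eulerOp (U := 0) ?_ (by simp) (coeff_zero_partitionSeries _) (by simp)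
    (by simp)
  refine eulerOp_partitionSeries_dropOnes _ (fun j k => adams k (ell c θ j))
    (fun j => by rw [hsym_zero, plethysm_one]) (fun j => adams_zero _)
    (fun j => eulerOp_plethysm_hsym _) (fun n hn => ?_) _ (by simp) fun n hn => ?_
  · rw [ell_one hc hθ, adams_psumN hn, mul_one]
  · rw [sum_adams_ell hc hθ hn, map_zero, add_zero]

/-- The generating series of the characteristics of `W-hat`. -/
def whitneySeries (c : ∀ n : ℕ, Equiv.Perm (Fin n)) (θ : ∀ n : ℕ, Subgroup.zpowers (c n) →* ℂˣ) :
    PowerSeries Symm :=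
  partitionSeries (dropOnes fun j m =>
    if Odd j then plethysm (hsym m) (pie c θ j) else plethysm (esym m) (pie c θ j))

theorem whitneyHat_eq (n : ℕ) :
    whitneyHat c θ n = chInv n (PowerSeries.coeff n (whitneySeries c θ)) := by
  rw [whitneySeries, ← sum_derangementPartitions _ (by simp [hsym_zero, plethysm_one])]
  rfl

theorem one_sub_mul_whitneySeries (hc : ∀ n : ℕ, (c n).IsCycleOn Set.univ)
    (hθ : ∀ n : ℕ, 1 ≤ n → IsPrimitiveRoot (θ n ⟨c n, Subgroup.mem_zpowers (c n)⟩) n) :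
    (1 - PowerSeries.C (psumN 1) * PowerSeries.X) * whitneySeries c θ =
      (1 + PowerSeries.C (psumN 2) * PowerSeries.X ^ 2) * altEsym := by
  -- U is the expansion of 2 p_2 t^2/(1 + p_2 t^2), the logarithmic derivative of 1 + p_2 t^2.
  set U : PowerSeries Symm := PowerSeries.mk fun i =>
    if i = 0 then 0 else if 2 ∣ i then 2 * (-1) ^ (i / 2 + 1) * psumN 2 ^ (i / 2) else 0 with hU
  have hU0 : PowerSeries.coeff 0 U = 0 := by rw [hU, PowerSeries.coeff_mk, if_pos rfl]
  have hUeq : (1 + PowerSeries.C (psumN 2) * PowerSeries.X ^ 2) * U =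
      2 * (PowerSeries.C (psumN 2) * PowerSeries.X ^ 2) := by
    have h2 : (2 : PowerSeries Symm) = PowerSeries.C 2 := (map_ofNat PowerSeries.C 2).symm
    ext1 n
    rw [add_mul, one_mul, mul_assoc, map_add, PowerSeries.coeff_C_mul, h2,
      PowerSeries.coeff_C_mul, PowerSeries.coeff_C_mul, PowerSeries.coeff_X_pow,
      PowerSeries.coeff_X_pow_mul']
    simp only [hU, PowerSeries.coeff_mk]
    rcases n with _ | _ | _ | n
    · simp
    · simp
    · simp
    · have h3 : (2 ∣ n + 1 + 1 + 1) ↔ (2 ∣ n + 1) := by omega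
      have h4 : (n + 1 + 1 + 1) / 2 = (n + 1) / 2 + 1 := by omega
      have h5 : n + 1 + 1 + 1 - 2 = n + 1 := by omega
      rw [h5, if_neg (show ¬ n + 1 + 1 + 1 = 0 by omega), if_neg (show ¬ n + 1 = 0 by omega),
        if_pos (show 2 ≤ n + 1 + 1 + 1 by omega), if_neg (show ¬ n + 1 + 1 + 1 = 2 by omega), h4]
      simp only [h3]
      split_ifs
      · ring
      · ring
  refine one_sub_mul_eq_of_eulerOp (U := U) ?_ ?_ (coeff_zero_partitionSeries _) ?_ hU0
  · refine eulerOp_partitionSeries_dropOnes _ (fun j k => if Odd j then adams k (pie c θ j)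
      else (-1) ^ (k + 1) * adams k (pie c θ j)) (fun j => ?_) (fun j => ?_) (fun j => ?_)
      (fun n hn => ?_) _ hU0 fun n hn => ?_
    · split_ifs
      · rw [hsym_zero, plethysm_one]
      · rw [esym_zero, plethysm_one]
    · split_ifs <;> simp [adams_zero]
    · split_ifs
      · exact eulerOp_plethysm_hsym _
      · exact eulerOp_plethysm_esym _
    · rw [if_pos odd_one, pie_one hc hθ, adams_psumN hn, mul_one]
    · rw [sum_adams_pie hc hθ hn, hU, PowerSeries.coeff_mk, if_neg hn.ne']
  · rw [map_add, Derivation.map_one_eq_zero, eulerOp_C_mul_X_pow, zero_add, hUeq, Nat.cast_ofNat]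
  · simp

end Derangements

/-! ### Identification of τ_n with e_n + p_2 e_{n-2}. -/

section Tau

open MvPolynomial

/-- The symmetric function `e_n + p_2 e_{n-2}`. -/
def tauSym (n : ℕ) : Symm := esym n + if 2 ≤ n then psumN 2 * esym (n - 2) else 0

theorem isHomog_psumN {k : ℕ} (hk : 0 < k) : IsHomog (psumN k) k := by
  have h := isWeightedHomogeneous_X ℂ (fun k : ℕ+ => (k : ℕ)) k.toPNat'
  rw [Nat.toPNat'_coe, if_pos hk] at h
  rwa [psumN_of_pos hk]

theorem isHomog_esym (n : ℕ) : IsHomog (esym n) n := isHomog_ch _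

theorem isHomog_tauSym (n : ℕ) : IsHomog (tauSym n) n := by
  refine (isHomog_esym n).add ?_
  split_ifs with h
  · have := (isHomog_psumN two_pos).mul (isHomog_esym (n - 2))
    rwa [Nat.add_sub_cancel' h] at this
  · exact isWeightedHomogeneous_zero _ _ _

theorem esymZ_natCast (k : ℕ) : esymZ k = esym k := by simp [esymZ]

theorem esymZ_of_neg {k : ℤ} (hk : k < 0) : esymZ k = 0 := if_neg (not_le.2 hk)

theorem newton_hsym (n : ℕ) : (n : Symm) * hsym n =
    ∑ x ∈ Finset.HasAntidiagonal.antidiagonal n, hsym x.1 * psumN x.2 := by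
  have h := congrArg (PowerSeries.coeff n) eulerOp_hsym
  rw [coeff_eulerOp, PowerSeries.coeff_mul] at h
  simpa only [PowerSeries.coeff_mk] using h

theorem newton_esym (n : ℕ) : (n : Symm) * esym n =
    ∑ x ∈ Finset.HasAntidiagonal.antidiagonal n, esym x.1 * ((-1) ^ (x.2 + 1) * psumN x.2) := by
  have h := congrArg (PowerSeries.coeff n) eulerOp_esym
  rw [coeff_eulerOp, PowerSeries.coeff_mul] at h
  simpa only [PowerSeries.coeff_mk] using h

theorem hsym_one : hsym 1 = psumN 1 := by
  have h := newton_hsym 1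
  simpa [Finset.Nat.antidiagonal_succ, hsym_zero, psumN_zero] using h

theorem esym_one : esym 1 = psumN 1 := by
  have h := newton_esym 1
  simpa [Finset.Nat.antidiagonal_succ, esym_zero, psumN_zero] using h

theorem two_mul_hsym_two : 2 * hsym 2 = psumN 1 ^ 2 + psumN 2 := by
  have h := newton_hsym 2
  simp [Finset.Nat.antidiagonal_succ, hsym_zero, hsym_one, psumN_zero] at h
  rw [h]
  ring

theorem two_mul_esym_two : 2 * esym 2 = psumN 1 ^ 2 - psumN 2 := by
  have h := newton_esym 2
  simp [Finset.Nat.antidiagonal_succ, esym_zero, esym_one, psumN_zero] at h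
  rw [h]
  ring

theorem three_mul_hsym_three : 3 * hsym 3 = hsym 2 * psumN 1 + psumN 1 * psumN 2 + psumN 3 := by
  have h := newton_hsym 3
  simp [Finset.Nat.antidiagonal_succ, hsym_zero, hsym_one, psumN_zero] at h
  rw [h]
  ring

theorem three_mul_esym_three : 3 * esym 3 = esym 2 * psumN 1 - psumN 1 * psumN 2 + psumN 3 := by
  have h := newton_esym 3
  simp [Finset.Nat.antidiagonal_succ, esym_zero, esym_one, psumN_zero] at h
  rw [h]
  ring

theorem esymZ_zero : esymZ 0 = 1 := (esymZ_natCast 0).trans esym_zero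

theorem esymZ_one : esymZ 1 = psumN 1 := (esymZ_natCast 1).trans esym_one

theorem esymZ_two : esymZ 2 = esym 2 := esymZ_natCast 2

theorem tauSym_eq_hsym {n : ℕ} (hn : n < 4) : tauSym n = hsym n := by
  interval_cases n
  · simp [tauSym, esym_zero, hsym_zero]
  · simp [tauSym, esym_one, hsym_one]
  · have h : tauSym 2 = esym 2 + psumN 2 := by simp [tauSym, esym_zero]
    rw [h]
    apply mul_left_cancel₀ (two_ne_zero (α := Symm))
    linear_combination two_mul_esym_two - two_mul_hsym_two
  · have h : tauSym 3 = esym 3 + psumN 2 * psumN 1 := by simp [tauSym, esym_one]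
    rw [h]
    have h6 : (6 : Symm) ≠ 0 := by norm_num
    apply mul_left_cancel₀ h6
    linear_combination 2 * three_mul_esym_three - 2 * three_mul_hsym_three +
      psumN 1 * two_mul_esym_two - psumN 1 * two_mul_hsym_two

theorem schur_eq_det {n : ℕ} (lam : n.Partition) (m : ℕ) (h : lam.parts.sup = m) :
    schur lam = Matrix.det (Matrix.of fun i j : Fin m =>
      esymZ ((conjPart lam (i.val + 1) : ℤ) - (i.val + 1 : ℤ) + (j.val + 1 : ℤ))) := by
  subst h
  rfl

theorem countP_replicate_one (m : ℕ) :
    (Multiset.replicate m 1).countP (fun k => 1 ≤ k) = m := by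
  rw [Multiset.countP_eq_card.2, Multiset.card_replicate]
  intro a ha
  rw [Multiset.eq_of_mem_replicate ha]

theorem countP_replicate_one_of_two_le (m : ℕ) {i : ℕ} (hi : 2 ≤ i) :
    (Multiset.replicate m 1).countP (fun k => i ≤ k) = 0 := by
  rw [Multiset.countP_eq_zero]
  intro a ha
  rw [Multiset.eq_of_mem_replicate ha]
  omega

theorem schur_hookThree {n : ℕ} (hn : 4 ≤ n) : schur (hookThree n hn) =
    esym (n - 2) * (psumN 1 ^ 2 - esym 2) - esym (n - 1) * psumN 1 + esym n := by
  have hsup : (hookThree n hn).parts.sup = 3 := by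
    have hparts : (hookThree n hn).parts = 3 ::ₘ Multiset.replicate (n - 3) 1 := rfl
    rw [hparts]
    refine le_antisymm (Multiset.sup_le.2 fun b hb => ?_)
      (Multiset.le_sup (Multiset.mem_cons_self _ _))
    rcases Multiset.mem_cons.1 hb with h | h
    · exact h.le
    · rw [Multiset.eq_of_mem_replicate h]
      norm_num
  have h1 : conjPart (hookThree n hn) 1 = n - 2 := by
    rw [conjPart, hookThree, Multiset.countP_cons_of_pos _ (by norm_num), countP_replicate_one]
    omega
  have h2 : conjPart (hookThree n hn) 2 = 1 := by
    rw [conjPart, hookThree, Multiset.countP_cons_of_pos _ (by norm_num),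
      countP_replicate_one_of_two_le _ le_rfl]
  have h3 : conjPart (hookThree n hn) 3 = 1 := by
    rw [conjPart, hookThree, Multiset.countP_cons_of_pos _ (by norm_num),
      countP_replicate_one_of_two_le _ (by norm_num)]
  -- The conjugate partition is (n-2, 1, 1), so the index rows are (n-2, n-1, n), (0, 1, 2), (-1, 0,
  -- 1).
  have e0 : ((n - 2 : ℕ) : ℤ) - 1 + 1 = (n - 2 : ℕ) := by omega
  have e1 : ((n - 2 : ℕ) : ℤ) - 1 + 2 = (n - 1 : ℕ) := by omega
  have e2 : ((n - 2 : ℕ) : ℤ) - 1 + 3 = (n : ℕ) := by omega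
  rw [schur_eq_det _ 3 hsup, Matrix.det_fin_three]
  simp only [Matrix.of_apply, Fin.val_zero, Fin.val_one, Fin.val_two, zero_add, Nat.reduceAdd, h1,
    h2, h3, Nat.cast_zero, Nat.cast_one, Nat.cast_ofNat]
  norm_num only
  rw [e0, e1, e2, esymZ_natCast, esymZ_natCast, esymZ_natCast, esymZ_zero, esymZ_one, esymZ_two,
    esymZ_of_neg (by norm_num)]
  ring

theorem schur_twoTwo {n : ℕ} (hn : 4 ≤ n) : schur (twoTwo n hn) =
    esym (n - 2) * esym 2 - esym (n - 1) * psumN 1 := by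
  have hsup : (twoTwo n hn).parts.sup = 2 := by
    have hparts : (twoTwo n hn).parts = 2 ::ₘ 2 ::ₘ Multiset.replicate (n - 4) 1 := rfl
    rw [hparts]
    refine le_antisymm (Multiset.sup_le.2 fun b hb => ?_)
      (Multiset.le_sup (Multiset.mem_cons_self _ _))
    rcases Multiset.mem_cons.1 hb with h | h
    · exact h.le
    rcases Multiset.mem_cons.1 h with h | h
    · exact h.le
    · rw [Multiset.eq_of_mem_replicate h]
      norm_num
  have h1 : conjPart (twoTwo n hn) 1 = n - 2 := by
    rw [conjPart, twoTwo, Multiset.countP_cons_of_pos _ (by norm_num),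
      Multiset.countP_cons_of_pos _ (by norm_num), countP_replicate_one]
    omega
  have h2 : conjPart (twoTwo n hn) 2 = 2 := by
    rw [conjPart, twoTwo, Multiset.countP_cons_of_pos _ (by norm_num),
      Multiset.countP_cons_of_pos _ (by norm_num), countP_replicate_one_of_two_le _ le_rfl]
  -- The conjugate partition is (n-2, 2), so the index rows are (n-2, n-1) and (1, 2).
  have e0 : ((n - 2 : ℕ) : ℤ) - 1 + 1 = (n - 2 : ℕ) := by omega
  have e1 : ((n - 2 : ℕ) : ℤ) - 1 + 2 = (n - 1 : ℕ) := by omega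
  rw [schur_eq_det _ 2 hsup, Matrix.det_fin_two]
  simp only [Matrix.of_apply, Fin.val_zero, Fin.val_one, zero_add, Nat.reduceAdd, h1,
    h2, Nat.cast_zero, Nat.cast_one, Nat.cast_ofNat]
  norm_num only
  rw [e0, e1, esymZ_natCast, esymZ_natCast, esymZ_one, esymZ_two]

theorem tau_eq (n : ℕ) : tau n = chInv n (tauSym n) := by
  rw [tau]
  split_ifs with hn
  · rw [irrChar, irrChar, ← chInv_sub, schur_hookThree, schur_twoTwo]
    congr 1
    rw [tauSym, if_pos (by omega)]
    -- In the difference of determinants the e_{n-1} terms cancel, and p_1^2 - 2 e_2 = p_2.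
    linear_combination -esym (n - 2) * two_mul_esym_two
  · rw [tauSym_eq_hsym (not_le.1 hn), hsym, chInv_ch _ fun _ _ => rfl]
    rfl

theorem ch_tau (n : ℕ) : ch (tau n) = tauSym n := by
  rw [tau_eq, ch_chInv (isHomog_tauSym n)]

theorem isClassFun_tau (n : ℕ) : IsClassFun (tau n) := by
  rw [tau_eq]
  exact isClassFun_chInv (isHomog_tauSym n)

/-- The value at the identity reads off the coefficient of p_1^n. Multiples of p_2 do not
contribute, so the degree is that of the sign character. -/
theorem tau_apply_one (n : ℕ) : tau n 1 = 1 := by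
  have h1 : chInv n (esym n) 1 = 1 := by
    rw [esym, chInv_ch _ (isClassFun_signChar n)]
    simp [signChar]
  rw [tau_eq, tauSym, chInv_add, Pi.add_apply, h1, add_eq_left]
  split_ifs with h
  · rw [chInv, psumN_of_pos two_pos, coeff_X_mul', if_neg, mul_zero]
    rw [Equiv.Perm.parts_partition, Equiv.Perm.cycleType_one, zero_add, typeExp_replicate]
    intro hmem
    have := Finset.mem_singleton.1 (Finsupp.support_single_subset hmem)
    exact absurd (congrArg (fun k : ℕ+ => (k : ℕ)) this) (by norm_num [Nat.toPNat'_coe])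
  · simp [chInv]

end Tau

/-! ### From symmetric functions back to class functions. -/

section Recurrence

open MvPolynomial

theorem chInv_zero_one : chInv 0 1 = 1 := by
  rw [← hsym_zero, hsym, chInv_ch _ fun _ _ => rfl]
  rfl

/-- Transfer of a recurrence from symmetric functions to class functions. -/
theorem chInv_succ_of_recurrence (S : ℕ → Symm) (u : ∀ n, Equiv.Perm (Fin n) → ℂ)
    (hu : ∀ n, IsClassFun (u n)) (h0 : S 0 = 1)
    (hS : ∀ n, S (n + 1) = psumN 1 * S n + ch (u (n + 1))) (n : ℕ) :
    chInv (n + 1) (S (n + 1)) = indS (chInv n (S n)) + u (n + 1) := by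
  -- `chInv n` sees only degree n, so homogeneity is needed to recover S n. The recurrence supplies
  -- it, without any degree count for plethysms.
  have hhom : ∀ n, IsHomog (S n) n := by
    intro n
    induction n with
    | zero => rw [h0]; exact isWeightedHomogeneous_one _ _
    | succ n ih =>
      rw [hS, add_comm n 1]
      refine ((isHomog_psumN one_pos).mul ih).add ?_
      rw [add_comm 1 n]
      exact isHomog_ch _
  have h1 : S (n + 1) = ch (indS (chInv n (S n)) + u (n + 1)) := by
    rw [hS, ch_add, ch_indS, ch_chInv (hhom n), ← psumN_coe 1]
    rfl
  have h2 : IsClassFun (indS (chInv n (S n))) := isClassFun_induce _ _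
  rw [h1, chInv_ch _ (h2.add (hu _))]

theorem coeff_succ_of_one_sub_mul {S E : PowerSeries Symm} {a : Symm}
    (h : (1 - PowerSeries.C a * PowerSeries.X) * S = E) (n : ℕ) :
    PowerSeries.coeff (n + 1) S = a * PowerSeries.coeff n S + PowerSeries.coeff (n + 1) E := by
  rw [← h, sub_mul, one_mul, mul_assoc, map_sub, PowerSeries.coeff_C_mul,
    PowerSeries.coeff_succ_X_mul]
  ring

theorem coeff_one_add_mul_altEsym (n : ℕ) :
    PowerSeries.coeff n ((1 + PowerSeries.C (psumN 2) * PowerSeries.X ^ 2) * altEsym) =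
      (-1) ^ n * tauSym n := by
  rw [add_mul, one_mul, mul_assoc, map_add, PowerSeries.coeff_C_mul, PowerSeries.coeff_X_pow_mul',
    tauSym]
  simp only [altEsym, PowerSeries.coeff_mk]
  split_ifs with h
  · obtain ⟨m, rfl⟩ := Nat.exists_eq_add_of_le h
    rw [Nat.add_sub_cancel_left, pow_add]
    ring
  · ring

theorem neg_one_pow_smul (n : ℕ) (F : Symm) : (-1 : ℂ) ^ n • F = (-1) ^ n * F := by
  rw [smul_eq_C_mul]
  simp

end Recurrence

end DerangementChar

end

open DerangementChar in
theorem theorem1p2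
    (c : ∀ n : ℕ, Equiv.Perm (Fin n))
    (hc : ∀ n : ℕ, (c n).IsCycleOn Set.univ)
    (θ : ∀ n : ℕ, Subgroup.zpowers (c n) →* ℂˣ)
    (hθ : ∀ n : ℕ, 1 ≤ n →
      IsPrimitiveRoot (θ n ⟨c n, Subgroup.mem_zpowers (c n)⟩) n) :
    (DerangementChar.lieHat c θ 0 = 1 ∧ DerangementChar.lieHat c θ 1 = 0 ∧
      DerangementChar.whitneyHat c θ 0 = 1 ∧ DerangementChar.whitneyHat c θ 1 = 0) ∧
    (∀ n : ℕ, DerangementChar.tau n 1 = 1) ∧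
    (∀ n : ℕ, DerangementChar.lieHat c θ (n + 1) =
      DerangementChar.indS (DerangementChar.lieHat c θ n) +
        (-1 : ℂ) ^ (n + 1) • DerangementChar.signChar (n + 1)) ∧
    (∀ n : ℕ, DerangementChar.whitneyHat c θ (n + 1) =
      DerangementChar.indS (DerangementChar.whitneyHat c θ n) +
        (-1 : ℂ) ^ (n + 1) • DerangementChar.tau (n + 1)) := by
  have hL0 : PowerSeries.coeff 0 (lieSeries c θ) = 1 := coeff_zero_partitionSeries _
  have hW0 : PowerSeries.coeff 0 (whitneySeries c θ) = 1 := coeff_zero_partitionSeries _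
  have hL : ∀ n, PowerSeries.coeff (n + 1) (lieSeries c θ) =
      psumN 1 * PowerSeries.coeff n (lieSeries c θ) + (-1) ^ (n + 1) * esym (n + 1) := fun n => by
    rw [coeff_succ_of_one_sub_mul (one_sub_mul_lieSeries hc hθ), altEsym, PowerSeries.coeff_mk]
  have hW : ∀ n, PowerSeries.coeff (n + 1) (whitneySeries c θ) =
      psumN 1 * PowerSeries.coeff n (whitneySeries c θ) + (-1) ^ (n + 1) * tauSym (n + 1) :=
    fun n => by
      rw [coeff_succ_of_one_sub_mul (one_sub_mul_whitneySeries hc hθ), coeff_one_add_mul_altEsym]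
  have hL1 : PowerSeries.coeff 1 (lieSeries c θ) = 0 := by
    have h := hL 0
    rw [hL0, zero_add, esym_one] at h
    rw [h]
    ring
  have hW1 : PowerSeries.coeff 1 (whitneySeries c θ) = 0 := by
    have h := hW 0
    rw [hW0, zero_add, tauSym_eq_hsym (by norm_num), hsym_one] at h
    rw [h]
    ring
  have hchz : ∀ n, chInv n 0 = 0 := fun n => by
    funext w
    simp [chInv]
  refine ⟨⟨?_, ?_, ?_, ?_⟩, tau_apply_one, fun n => ?_, fun n => ?_⟩
  · rw [lieHat_eq, hL0, chInv_zero_one]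
  · rw [lieHat_eq, hL1, hchz]
  · rw [whitneyHat_eq, hW0, chInv_zero_one]
  · rw [whitneyHat_eq, hW1, hchz]
  · rw [lieHat_eq, lieHat_eq]
    exact chInv_succ_of_recurrence (fun n => PowerSeries.coeff n (lieSeries c θ))
      (fun n => (-1 : ℂ) ^ n • signChar n) (fun n => (isClassFun_signChar n).smul _) hL0
      (fun n => by rw [hL, ch_smul, neg_one_pow_smul, esym]) n
  · rw [whitneyHat_eq, whitneyHat_eq]
    exact chInv_succ_of_recurrence (fun n => PowerSeries.coeff n (whitneySeries c θ))
      (fun n => (-1 : ℂ) ^ n • tau n) (fun n => (isClassFun_tau n).smul _) hW0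
      (fun n => by rw [hW, ch_smul, neg_one_pow_smul, ch_tau]) n
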